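/- Let $n,m\ge 0$ be integers; "smooth" means $C^\infty$. Let $U\subset\mathbb{R}^n$ be open and simply connected and let $\varphi_1,\dots,\varphi_m:U\to\mathbb{R}$ be smooth functions whose Hessians satisfy $[\operatorname{Hess}\varphi_i,\operatorname{Hess}\varphi_j]=0$ on $U$ for $1\le i,j\le m$. Let $\mathcal{G}=(\nabla\varphi_1,\dots,\nabla\varphi_m):U\to M_{n\times m}(\mathbb{R})$ be the matrix whose columns are the gradients, and let $\varphi=(\varphi_1,\dots,\varphi_m)^t$. (a) For every $x\in U$ there are an open set $V\subset U$ containing $x$ and a smooth map $\Omega:V\to GL(\mathbb{R}^m)$ such that $$d\Omega=\mathcal{G}^t\,d\mathcal{G}\quad\text{and}\quad \Omega+\Omega^t=\mathcal{G}^t\mathcal{G}+I .\qquad(*)$$ (b) For every open $V\subset U$ and every smooth $\Omega:V\to GL(\mathbb{R}^m)$ satisfying $(*)$, the map $$f_{\varphi,\Omega}=\begin{pmatrix}\mathrm{id}-\mathcal{G}\Omega^{-1}\varphi\\ \Omega^{-1}\varphi\end{pmatrix}:V\to\mathbb{R}^{n}\oplus\mathbb{R}^m=\mathbb{R}^{n+m}$$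 is smooth, the set of its regular points (the points of $V$ at which its differential is injective) is open, and on that set $f_{\varphi,\Omega}$ is an immersion with flat normal bundle, that is, the curvature $R^\perp(X,Y)\xi=\nabla^\perp_X\nabla^\perp_Y\xi-\nabla^\perp_Y\nabla^\perp_X\xi-\nabla^\perp_{[X,Y]}\xi$ of its normal connection $\nabla^\perp$ vanishes. (c) Conversely, let $M^n$ be a smooth $n$-dimensional manifold and $f:M^n\to\mathbb{R}^{n+m}$ a smooth immersion (isometric for the induced metric) with flat normal bundle. Then every $p\in M$ has an open neighbourhood on which $f$ arises, up to a translation of $\mathbb{R}^{n+m}$, in this way: there are an open simply connected $U\subset\mathbb{R}^n$, smooth functions $\varphi_1,\dots,\varphi_m$ on $U$ with pairwise commuting Hessians, an open $V\subset U$, a smooth $\Omega:V\to GL(\mathbb{R}^m)$ satisfying $(*)$, a smooth chart $\psi$ of $M$ from an open neighbourhood $W$ of $p$ onto $V$, and a vector $c\in\mathbb{R}^{n+m}$ such that $f=f_{\varphi,\Omega}\circ\psi+c$ on $W$. -/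

import Mathlib

open scoped ContDiff Manifold Matrix

noncomputable section

namespace FlatNormal

/-! ### Submanifold geometry: the normal bundle of an immersion and its curvature -/

section NormalBundle

variable {E F : Type*} [NormedAddCommGroup E] [NormedSpace ℝ E]
  [NormedAddCommGroup F] [InnerProductSpace ℝ F] [CompleteSpace F]

/-- `g` is a smooth immersion on `S`: it is smooth there, with injective differential. -/
def IsImmersionOn (g : E → F) (S : Set E) : Prop :=
  ContDiffOn ℝ ∞ g S ∧ ∀ x ∈ S, Function.Injective (fderiv ℝ g x)

/-- The regular points of `g` in `V`: those at which the differential of `g` is injective. -/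
def regularPoints (g : E → F) (V : Set E) : Set E :=
  {x ∈ V | Function.Injective (fderiv ℝ g x)}

/-- The normal space of `g` at `x`: the orthogonal complement of the image of the differential. -/
def normalSpace (g : E → F) (x : E) : Submodule ℝ F :=
  (LinearMap.range (fderiv ℝ g x : E →ₗ[ℝ] F))ᗮ

/-- The normal connection `∇^⊥_X ξ`: the derivative of `ξ` (a vector field along `g`) in the
direction `X`, projected orthogonally onto the normal space. -/
def normalConnection (g : E → F) (X : E → E) (ξ : E → F) : E → F := fun x =>
  ((LinearMap.range (fderiv ℝ g x : E →ₗ[ℝ] F))ᗮ).starProjection (fderiv ℝ ξ x (X x))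

/-- The curvature of the normal connection,
`R^⊥(X, Y) ξ = ∇^⊥_X ∇^⊥_Y ξ - ∇^⊥_Y ∇^⊥_X ξ - ∇^⊥_[X,Y] ξ`. -/
def normalCurvature (g : E → F) (X Y : E → E) (ξ : E → F) : E → F := fun x =>
  normalConnection g X (normalConnection g Y ξ) x
    - normalConnection g Y (normalConnection g X ξ) x
    - normalConnection g (VectorField.lieBracket ℝ X Y) ξ x

/-- The normal bundle of `g` over the open set `S` is flat: the curvature `R^⊥(X, Y) ξ` vanishes
for all local smooth vector fields `X`, `Y` and local smooth normal fields `ξ`. -/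
def FlatNormalBundleOn (g : E → F) (S : Set E) : Prop :=
  ∀ T ⊆ S, IsOpen T → ∀ (X Y : E → E) (ξ : E → F),
    ContDiffOn ℝ ∞ X T → ContDiffOn ℝ ∞ Y T → ContDiffOn ℝ ∞ ξ T →
    (∀ x ∈ T, ξ x ∈ normalSpace g x) →
    ∀ x ∈ T, normalCurvature g X Y ξ x = 0

end NormalBundle

/-- Euclidean space `ℝ^n`. -/
abbrev R (n : ℕ) : Type := EuclideanSpace ℝ (Fin n)

/-- Euclidean space `ℝ^{n+m} = ℝ^n ⊕ ℝ^m`, with coordinates indexed by the disjoint union. -/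
abbrev RR (n m : ℕ) : Type := EuclideanSpace ℝ (Fin n ⊕ Fin m)

section Manifold

variable (n : ℕ) {F : Type*} [NormedAddCommGroup F] [InnerProductSpace ℝ F] [CompleteSpace F]
  {M : Type*} [TopologicalSpace M] [ChartedSpace (R n) M]

/-- `f` is a smooth immersion of the manifold `M` into the Euclidean space `F`; it is an
isometric immersion for the metric that it induces on `M`. -/
def IsSmoothImmersion (f : M → F) : Prop :=
  ContMDiff (𝓡 n) 𝓘(ℝ, F) ∞ f ∧
    ∀ p : M, Function.Injective (mfderiv (𝓡 n) 𝓘(ℝ, F) f p)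

/-- The immersion `f` of the manifold `M` has flat normal bundle: its normal curvature, computed
in the charts of `M`, vanishes. -/
def HasFlatNormalBundle (f : M → F) : Prop :=
  ∀ e ∈ atlas (R n) M, FlatNormalBundleOn (f ∘ e.symm) e.target

end Manifold

/-! ### The data of the construction -/

section Data

variable {n m : ℕ}

/-- The Hessian of `ψ` at `x`, as the endomorphism `v ↦ D_v (∇ψ)` of `ℝ^n`. -/
def hess (ψ : R n → ℝ) (x : R n) : R n →L[ℝ] R n :=
  fderiv ℝ (gradient ψ) x

/-- The functions `φ_1, …, φ_m` are smooth on `U` with pairwise commuting Hessians. -/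
def CommutingHessiansOn (φ : Fin m → R n → ℝ) (U : Set (R n)) : Prop :=
  (∀ i, ContDiffOn ℝ ∞ (φ i) U) ∧
    ∀ x ∈ U, ∀ i j, hess (φ i) x * hess (φ j) x = hess (φ j) x * hess (φ i) x

/-- The matrix `𝒢 = (∇φ_1, …, ∇φ_m)`, whose columns are the gradients. -/
def gradMatrix (φ : Fin m → R n → ℝ) (x : R n) : Matrix (Fin n) (Fin m) ℝ :=
  Matrix.of fun k i => gradient (φ i) x k

/-- The differential `dB(v)` at `x` of a matrix-valued map `B`, taken entrywise. -/
def dMatrix {ι κ : Type*} (B : R n → Matrix ι κ ℝ) (x v : R n) : Matrix ι κ ℝ :=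
  Matrix.of fun a b => fderiv ℝ (fun y => B y a b) x v

/-- `Ω : V → GL(ℝ^m)` is smooth, `dΩ = 𝒢ᵗ d𝒢`, and `Ω + Ωᵗ = 𝒢ᵗ 𝒢 + I`. -/
structure IsAdapted (φ : Fin m → R n → ℝ) (Ω : R n → Matrix (Fin m) (Fin m) ℝ)
    (V : Set (R n)) : Prop where
  smooth : ∀ i j, ContDiffOn ℝ ∞ (fun x => Ω x i j) V
  invertible : ∀ x ∈ V, IsUnit (Ω x)
  deriv_eq : ∀ x ∈ V, ∀ v, dMatrix Ω x v = (gradMatrix φ x)ᵀ * dMatrix (gradMatrix φ) x v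
  add_transpose : ∀ x ∈ V, Ω x + (Ω x)ᵀ = (gradMatrix φ x)ᵀ * gradMatrix φ x + 1

/-- The vector `Ω⁻¹ φ`. -/
def coeff (φ : Fin m → R n → ℝ) (Ω : R n → Matrix (Fin m) (Fin m) ℝ) (x : R n) : Fin m → ℝ :=
  (Ω x)⁻¹ *ᵥ (fun i => φ i x)

/-- The map `x ↦ (x - 𝒢 Ω⁻¹ φ, Ω⁻¹ φ)` into `ℝ^n ⊕ ℝ^m`. -/
def ribaucourMap (φ : Fin m → R n → ℝ) (Ω : R n → Matrix (Fin m) (Fin m) ℝ) (x : R n) :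
    RR n m :=
  WithLp.toLp 2 (Sum.elim (fun k => x k - (gradMatrix φ x *ᵥ coeff φ Ω x) k) (coeff φ Ω x))

end Data

end FlatNormal

end

/-!
Two descriptions of a flat normal bundle meet in this file.

*Parallel frames.* An immersion has flat normal bundle exactly when, locally, its normal bundle has
an orthonormal frame `ζ` whose derivatives are tangent (`IsParallelNormalFrame`). With such a frame
the normal connection is the flat derivative of the coefficients, so that its curvature vanishes
(`IsParallelNormalFrame.flatNormalBundleOn`). Conversely, let `P(x)` be the orthogonal projection
onto the normal space. A normal field is parallel if and only if `dξ = (dP) ξ`, and for this linear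
system the integrability condition on normal vectors is that the operators `dP(u)` and `dP(v)`
commute on them, which is the vanishing of the normal curvature (Ricci equation,
`FlatNormalBundleOn.fderiv_normalProj_comm`). The system is solved along the rays issuing from a
point (`exists_parallel_section`): a Grönwall estimate shows that the result is differentiable with
the expected derivative, and the equation itself then gives smoothness.

*Frames and the data `(φ, Ω)`.* Write the frame as a matrix with blocks `a` (in `ℝ^n`) and `b`
(in `ℝ^m`). The relations `Ω = (1 - b)⁻¹`, `𝒢 = a Ω` translate

* `aᵗ a + bᵗ b = I` (orthonormal) into `Ω + Ωᵗ = 𝒢ᵗ 𝒢 + I`,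
* `aᵗ da + bᵗ db = 0` (parallel) into `dΩ = 𝒢ᵗ d𝒢`,
* `aᵗ df₁ + bᵗ df₂ = 0` (normal) into `dφ = 𝒢ᵗ dx`, where `φ = Ω f₂` and `x = f₁ + 𝒢 f₂`.

Read in one direction this is the parallel frame `(𝒢 Ω⁻¹ η, η - Ω⁻¹ η)` along the map of the
construction (`IsAdapted.isParallelNormalFrame`). Read in the other direction it recovers `φ` and
`Ω` from a parallel frame, once `x` is a system of coordinates
(`exists_eq_ribaucourMap_of_frameCoord_eq`). Changing signs of frame vectors makes `1 - b`
invertible at the given point, and a translation makes `f₂` vanish there, which makes `dx`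
injective.

*Existence of `Ω`.* The entries `⟪∇φ_i, (Hess φ_j) ·⟫` of `𝒢ᵗ d𝒢` are closed `1`-forms precisely
when the Hessians commute (`fderiv_hessForm_symm_iff`), so that the Poincaré lemma on a ball gives
`Ω`; invertibility is automatic because the symmetric part of `Ω` is positive definite.
-/

noncomputable section

namespace FlatNormal

open Set Metric Filter Topology

/-! ### Parallel sections of linear connections -/

section Frobenius

-- needed for the norm on iterated spaces of operators such as `E →L[ℝ] E →L[ℝ] F →L[ℝ] F`
set_option maxSynthPendingDepth 2

variable {E F : Type*} [NormedAddCommGroup E] [NormedSpace ℝ E]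
  [NormedAddCommGroup F] [NormedSpace ℝ F]

/-- Grönwall's inequality on the unit interval, with Lipschitz constant `1` and a crude constant. -/
lemma norm_le_of_norm_deriv_le_unitInterval {f f' : ℝ → F} {δ ε : ℝ} (hδ : 0 ≤ δ) (hε : 0 ≤ ε)
    (hf : ∀ t ∈ Icc (0 : ℝ) 1, HasDerivWithinAt f (f' t) (Icc 0 1) t) (h0 : ‖f 0‖ ≤ δ)
    (hb : ∀ t ∈ Icc (0 : ℝ) 1, ‖f' t‖ ≤ ‖f t‖ + ε) :
    ∀ t ∈ Icc (0 : ℝ) 1, ‖f t‖ ≤ 3 * (δ + ε) := by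
  intro t ht
  have h := norm_le_gronwallBound_of_norm_deriv_right_le (f := f) (f' := f') (δ := δ) (K := 1)
    (ε := ε) (a := 0) (b := 1) (fun t ht => (hf t ht).continuousWithinAt)
    (fun t ht => (hf t (Ico_subset_Icc_self ht)).mono_of_mem_nhdsWithin
      (Icc_mem_nhdsGE_of_mem ht)) h0
    (fun t ht => by simpa using hb t (Ico_subset_Icc_self ht)) t ht
  refine h.trans ?_
  rw [sub_zero]
  refine (gronwallBound_mono hδ hε zero_le_one ht.2).trans ?_
  rw [gronwallBound_of_K_ne_0 one_ne_zero]
  have := Real.exp_one_lt_d9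
  norm_num
  nlinarith

/-- A linear equation on the unit interval with coefficients of norm at most `1 / 2` has a
solution with any initial value. -/
lemma exists_solution_unitInterval [CompleteSpace F] {B : ℝ → F →L[ℝ] F}
    (hB : ContinuousOn B (Icc 0 1)) (hb : ∀ t ∈ Icc (0 : ℝ) 1, ‖B t‖ ≤ 1 / 2) (y₀ : F) :
    ∃ y : ℝ → F, y 0 = y₀ ∧
      ∀ t ∈ Icc (0 : ℝ) 1, HasDerivWithinAt y (B t (y t)) (Icc 0 1) t := by
  have h : IsPicardLindelof (fun t y => B t y) (tmin := 0) (tmax := 1)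
      ⟨0, left_mem_Icc.2 zero_le_one⟩ y₀ ‖y₀‖₊ 0 ‖y₀‖₊ 1 := by
    refine ⟨fun t ht => ?_, fun y _ => hB.clm_apply continuousOn_const, fun t ht y hy => ?_, ?_⟩
    · refine ((B t).lipschitz.weaken ?_).lipschitzOnWith
      rw [← NNReal.coe_le_coe]
      simpa using (hb t ht).trans (by norm_num)
    · have h1 : ‖y‖ ≤ 2 * ‖y₀‖ := by
        have h2 : ‖y - y₀‖ ≤ ‖y₀‖ := by simpa [dist_eq_norm] using hy
        linarith [norm_le_norm_add_norm_sub' y y₀]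
      refine ((B t).le_of_opNorm_le_of_le (hb t ht) h1).trans (le_of_eq ?_)
      simp
    · simp
  exact h.exists_eq_forall_mem_Icc_hasDerivWithinAt₀

/-- Uniform second-order Taylor estimates for a `C²` map near a point. -/
lemma exists_taylor_bounds {G : Type*} [NormedAddCommGroup G] [NormedSpace ℝ G] {A : E → G}
    {x₀ : E} {S : Set E} (hS : S ∈ 𝓝 x₀) (hA : ContDiffAt ℝ 2 A x₀) :
    ∃ C ≥ 1, ∃ r > 0, ball x₀ r ⊆ S ∧ (∀ x ∈ ball x₀ r, DifferentiableAt ℝ A x) ∧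
      (∀ x ∈ ball x₀ r, ‖A x‖ ≤ C) ∧
      (∀ x ∈ ball x₀ r, ‖fderiv ℝ A x‖ ≤ C) ∧
      (∀ x ∈ ball x₀ r, ∀ z ∈ ball x₀ r, ‖A z - A x‖ ≤ C * ‖z - x‖) ∧
      (∀ x ∈ ball x₀ r, ∀ z ∈ ball x₀ r,
        ‖A z - A x - fderiv ℝ A x (z - x)‖ ≤ C * ‖z - x‖ ^ 2) := by
  have hdA : ContDiffAt ℝ 1 (fderiv ℝ A) x₀ := hA.fderiv_right (by norm_num)
  obtain ⟨K, s, hs, hK⟩ := hdA.exists_lipschitzOnWith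
  have h1 : ∀ᶠ x in 𝓝 x₀, ‖A x‖ < ‖A x₀‖ + 1 :=
    hA.continuousAt.norm.eventually_lt continuousAt_const (by simp)
  have h2 : ∀ᶠ x in 𝓝 x₀, ‖fderiv ℝ A x‖ < ‖fderiv ℝ A x₀‖ + 1 :=
    hdA.continuousAt.norm.eventually_lt continuousAt_const (by simp)
  have h3 : ∀ᶠ x in 𝓝 x₀, DifferentiableAt ℝ A x := by
    filter_upwards [(hA.of_le (m := 1) (by norm_num)).eventually (by simp)] with x hx
    exact hx.differentiableAt (by simp)
  obtain ⟨r, hr, hsub⟩ := Metric.mem_nhds_iff.1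
    (inter_mem (inter_mem hs hS) (inter_mem (inter_mem h1 h2) h3))
  set C : ℝ := ‖A x₀‖ + ‖fderiv ℝ A x₀‖ + K + 1 with hC
  have hK0 : (0 : ℝ) ≤ K := K.2
  have hd : ∀ x ∈ ball x₀ r, ‖fderiv ℝ A x‖ ≤ C := fun x hx => by
    have := (hsub hx).2.1.2
    simp only [mem_ofPred_eq] at this
    linarith [norm_nonneg (A x₀)]
  have hdiff : ∀ x ∈ ball x₀ r, DifferentiableAt ℝ A x := fun x hx => (hsub hx).2.2
  refine ⟨C, by linarith [norm_nonneg (A x₀), norm_nonneg (fderiv ℝ A x₀)], r, hr,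
    fun x hx => (hsub hx).1.2, hdiff, fun x hx => ?_, hd, fun x hx z hz => ?_,
    fun x hx z hz => ?_⟩
  · have := (hsub hx).2.1.1
    simp only [mem_ofPred_eq] at this
    linarith [norm_nonneg (fderiv ℝ A x₀)]
  · exact (convex_ball x₀ r).norm_image_sub_le_of_norm_fderiv_le hdiff hd hx hz
  · have hseg : segment ℝ x z ⊆ ball x₀ r := (convex_ball x₀ r).segment_subset hx hz
    have := (convex_segment x z).norm_image_sub_le_of_norm_hasFDerivWithin_le' (𝕜 := ℝ) (f := A)
      (f' := fderiv ℝ A) (φ := fderiv ℝ A x) (C := K * ‖z - x‖)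
      (fun p hp => (hdiff p (hseg hp)).hasFDerivAt.hasFDerivWithinAt)
      (fun p hp => by
        refine (hK.norm_sub_le (hsub (hseg hp)).1.1 (hsub hx).1.1).trans ?_
        gcongr
        exact norm_sub_le_of_mem_segment hp)
      (left_mem_segment ℝ x z) (right_mem_segment ℝ x z)
    refine this.trans ?_
    rw [mul_assoc, ← sq]
    gcongr
    linarith [norm_nonneg (A x₀), norm_nonneg (fderiv ℝ A x₀)]

/-- Radial parallel transport is differentiable in the endpoint, with the expected derivative, if
the curvature of the linear connection `dξ = A ξ` vanishes on the transported vectors. If `y` and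
`z` are the solutions along the rays to `x₀ + u` and `x₀ + u + v`, the error
`w(t) = z(t) - y(t) - t A(x₀ + t u)(v) y(t)` satisfies `w' = A(x₀ + t u)(u) w + O(‖v‖²)`, and
Grönwall's inequality bounds `w(1)` by `O(‖v‖²)`. -/
lemma hasFDerivAt_of_radial_solutions {A : E → E →L[ℝ] F →L[ℝ] F} {x₀ : E} {C r : ℝ}
    (hC : 1 ≤ C) (hCr : C * r ≤ 1 / 2)
    (hdiff : ∀ x ∈ ball x₀ r, DifferentiableAt ℝ A x)
    (hA0 : ∀ x ∈ ball x₀ r, ‖A x‖ ≤ C) (hA1 : ∀ x ∈ ball x₀ r, ‖fderiv ℝ A x‖ ≤ C)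
    (hA2 : ∀ x ∈ ball x₀ r, ∀ z ∈ ball x₀ r, ‖A z - A x‖ ≤ C * ‖z - x‖)
    (hA3 : ∀ x ∈ ball x₀ r, ∀ z ∈ ball x₀ r,
      ‖A z - A x - fderiv ℝ A x (z - x)‖ ≤ C * ‖z - x‖ ^ 2)
    {y : E → ℝ → F} {y₀ : F} (hy0 : ∀ u, ‖u‖ < r → y u 0 = y₀)
    (hy : ∀ u, ‖u‖ < r → ∀ t ∈ Icc (0 : ℝ) 1,
      HasDerivWithinAt (y u) (A (x₀ + t • u) u (y u t)) (Icc 0 1) t)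
    (hflat : ∀ u, ‖u‖ < r → ∀ t ∈ Icc (0 : ℝ) 1, ∀ v,
      fderiv ℝ A (x₀ + t • u) u v (y u t) + A (x₀ + t • u) v (A (x₀ + t • u) u (y u t)) =
      fderiv ℝ A (x₀ + t • u) v u (y u t) + A (x₀ + t • u) u (A (x₀ + t • u) v (y u t)))
    {u : E} (hu : ‖u‖ < r) :
    HasFDerivAt (fun u => y u 1) ((A (x₀ + u)).flip (y u 1)) u := by
  have hr1 : r ≤ 1 / 2 := by
    rcases le_or_gt r 0 with h | h
    · linarith
    · nlinarith
  have hmem : ∀ u : E, ‖u‖ < r → ∀ t ∈ Icc (0 : ℝ) 1, x₀ + t • u ∈ ball x₀ r := by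
    intro u hu t ht
    rw [mem_ball_iff_norm, add_sub_cancel_left, norm_smul, Real.norm_of_nonneg ht.1]
    exact (mul_le_of_le_one_left (norm_nonneg _) ht.2).trans_lt hu
  have hB : ∀ u : E, ‖u‖ < r → ∀ t ∈ Icc (0 : ℝ) 1, ‖A (x₀ + t • u) u‖ ≤ 1 := by
    intro u hu t ht
    refine ((A _).le_of_opNorm_le_of_le (hA0 _ (hmem u hu t ht)) hu.le).trans ?_
    linarith
  set Y : ℝ := 3 * (‖y₀‖ + 0) with hY
  have hY0 : 0 ≤ Y := by positivity
  have hyY : ∀ u : E, ‖u‖ < r → ∀ t ∈ Icc (0 : ℝ) 1, ‖y u t‖ ≤ Y := by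
    intro u hu
    refine norm_le_of_norm_deriv_le_unitInterval (norm_nonneg _) le_rfl (hy u hu)
      (by rw [hy0 u hu]) fun t ht => ?_
    simpa using (A (x₀ + t • u) u).le_of_opNorm_le_of_le (hB u hu t ht) le_rfl
  set c : ℝ := 3 * (0 + (2 * C + 12 * C ^ 2) * Y) with hc
  -- the quadratic error estimate
  have key : ∀ v : E, ‖u + v‖ < r → ‖y (u + v) 1 - y u 1 - A (x₀ + u) v (y u 1)‖
      ≤ c * ‖v‖ ^ 2 := by
    intro v huv
    have hpt : ∀ t : ℝ, x₀ + t • (u + v) - (x₀ + t • u) = t • v := fun t => by module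
    have htv : ∀ t ∈ Icc (0 : ℝ) 1, ‖t • v‖ ≤ ‖v‖ := fun t ht => by
      rw [norm_smul, Real.norm_of_nonneg ht.1]
      exact mul_le_of_le_one_left (norm_nonneg _) ht.2
    have hAd : ∀ t ∈ Icc (0 : ℝ) 1, ‖A (x₀ + t • (u + v)) - A (x₀ + t • u)‖ ≤ C * ‖v‖ :=
      fun t ht => by
        refine (hA2 _ (hmem u hu t ht) _ (hmem _ huv t ht)).trans ?_
        rw [hpt]
        gcongr
        exact htv t ht
    have hdist : ∀ t ∈ Icc (0 : ℝ) 1, ‖y (u + v) t - y u t‖ ≤ 3 * (0 + 2 * C * ‖v‖ * Y) := by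
      refine norm_le_of_norm_deriv_le_unitInterval le_rfl (by positivity)
        (fun t ht => (hy _ huv t ht).sub (hy u hu t ht))
        (by rw [hy0 _ huv, hy0 _ hu]; simp) fun t ht => ?_
      have e : A (x₀ + t • (u + v)) (u + v) (y (u + v) t) - A (x₀ + t • u) u (y u t) =
          A (x₀ + t • u) u (y (u + v) t - y u t) +
            ((A (x₀ + t • (u + v)) - A (x₀ + t • u)) (u + v) + A (x₀ + t • u) v)
              (y (u + v) t) := by
        simp only [map_add, map_sub, add_apply,
          sub_apply]
        abel
      rw [e]
      refine (norm_add_le _ _).trans (add_le_add ?_ ?_)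
      · exact ((A (x₀ + t • u) u).le_of_opNorm_le_of_le (hB u hu t ht) le_rfl).trans_eq (one_mul _)
      · refine ContinuousLinearMap.le_of_opNorm_le_of_le _ ?_ (hyY _ huv t ht)
        have h1 := ContinuousLinearMap.le_of_opNorm_le_of_le _ (hAd t ht) huv.le
        have h2 := ContinuousLinearMap.le_of_opNorm_le_of_le _ (hA0 _ (hmem u hu t ht))
          (le_refl ‖v‖)
        have h3 : C * ‖v‖ * r ≤ C * ‖v‖ * 1 := by gcongr; linarith
        linarith [norm_add_le ((A (x₀ + t • (u + v)) - A (x₀ + t • u)) (u + v))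
          (A (x₀ + t • u) v)]
    have hw := norm_le_of_norm_deriv_le_unitInterval (δ := 0)
      (ε := (2 * C + 12 * C ^ 2) * Y * ‖v‖ ^ 2)
      (f := fun t => y (u + v) t - y u t - t • A (x₀ + t • u) v (y u t)) le_rfl (by positivity)
      (fun t ht => by
        have hl : HasDerivWithinAt (fun t : ℝ => x₀ + t • u) u (Icc 0 1) t := by
          simpa using ((hasDerivWithinAt_id t (Icc (0 : ℝ) 1)).smul_const u).const_add x₀
        have hAt : HasDerivWithinAt (fun t : ℝ => A (x₀ + t • u))
            (fderiv ℝ A (x₀ + t • u) u) (Icc 0 1) t :=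
          (hdiff _ (hmem u hu t ht)).hasFDerivAt.comp_hasDerivWithinAt t hl
        have hAv : HasDerivWithinAt (fun t : ℝ => A (x₀ + t • u) v)
            (fderiv ℝ A (x₀ + t • u) u v) (Icc 0 1) t := by
          simpa using hAt.clm_apply (hasDerivWithinAt_const t _ v)
        exact ((hy _ huv t ht).sub (hy u hu t ht)).sub
          ((hasDerivWithinAt_id t _).smul (hAv.clm_apply (hy u hu t ht))))
      (by simp [hy0 _ huv, hy0 _ hu])
      (fun t ht => by
        -- flatness turns the derivative of the error term into `B w` plus quadratic terms
        have e : A (x₀ + t • (u + v)) (u + v) (y (u + v) t) - A (x₀ + t • u) u (y u t) -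
            (t • (fderiv ℝ A (x₀ + t • u) u v (y u t) +
              A (x₀ + t • u) v (A (x₀ + t • u) u (y u t))) +
              (1 : ℝ) • A (x₀ + t • u) v (y u t)) =
            A (x₀ + t • u) u (y (u + v) t - y u t - t • A (x₀ + t • u) v (y u t)) +
            (((A (x₀ + t • (u + v)) - A (x₀ + t • u) - fderiv ℝ A (x₀ + t • u) (t • v)) u +
              (A (x₀ + t • (u + v)) - A (x₀ + t • u)) v) (y (u + v) t) +
            (A (x₀ + t • u) v + t • fderiv ℝ A (x₀ + t • u) v u) (y (u + v) t - y u t)) := by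
          rw [hflat u hu t ht v]
          simp only [map_add, map_sub, map_smul, add_apply,
            sub_apply, smul_apply]
          module
        simp only [id]
        rw [e]
        refine (norm_add_le _ _).trans (add_le_add ?_ ?_)
        · exact ((A (x₀ + t • u) u).le_of_opNorm_le_of_le (hB u hu t ht) le_rfl).trans_eq (one_mul _)
        have hu1 : ‖u‖ ≤ 1 := by linarith
        have h1 : ‖(A (x₀ + t • (u + v)) - A (x₀ + t • u) -
            fderiv ℝ A (x₀ + t • u) (t • v)) u‖ ≤ C * ‖v‖ ^ 2 * 1 := by
          refine ContinuousLinearMap.le_of_opNorm_le_of_le _ ?_ hu1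
          have := hA3 _ (hmem u hu t ht) _ (hmem _ huv t ht)
          rw [hpt] at this
          refine this.trans ?_
          gcongr
          exact htv t ht
        have h2 : ‖(A (x₀ + t • (u + v)) - A (x₀ + t • u)) v‖ ≤ C * ‖v‖ * ‖v‖ :=
          ContinuousLinearMap.le_of_opNorm_le_of_le _ (hAd t ht) le_rfl
        have h3 : ‖A (x₀ + t • u) v‖ ≤ C * ‖v‖ :=
          ContinuousLinearMap.le_of_opNorm_le_of_le _ (hA0 _ (hmem u hu t ht)) le_rfl
        have h4 : ‖t • fderiv ℝ A (x₀ + t • u) v u‖ ≤ C * ‖v‖ * 1 := by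
          rw [norm_smul, Real.norm_of_nonneg ht.1]
          refine (mul_le_of_le_one_left (norm_nonneg _) ht.2).trans ?_
          refine ContinuousLinearMap.le_of_opNorm_le_of_le _ ?_ hu1
          exact ContinuousLinearMap.le_of_opNorm_le_of_le _ (hA1 _ (hmem u hu t ht)) le_rfl
        have h5 := ContinuousLinearMap.le_of_opNorm_le_of_le _
          ((norm_add_le _ _).trans (add_le_add h1 h2)) (hyY _ huv t ht)
        have h6 := ContinuousLinearMap.le_of_opNorm_le_of_le _
          ((norm_add_le _ _).trans (add_le_add h3 h4)) (hdist t ht)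
        refine (norm_add_le _ _).trans ((add_le_add h5 h6).trans (le_of_eq ?_))
        ring)
      1 (right_mem_Icc.2 zero_le_one)
    simp only [one_smul] at hw
    refine hw.trans (le_of_eq ?_)
    rw [hc]
    ring
  rw [hasFDerivAt_iff_isLittleO_nhds_zero]
  refine Asymptotics.IsBigO.trans_isLittleO (g := fun v : E => ‖v‖ ^ 2) ?_ ?_
  · refine Asymptotics.IsBigO.of_bound c ?_
    have hev : ∀ᶠ v in 𝓝 (0 : E), ‖u + v‖ < r := by
      have : ContinuousAt (fun v : E => ‖u + v‖) 0 := by fun_prop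
      exact this.eventually_lt continuousAt_const (by simpa using hu)
    filter_upwards [hev] with v hv
    simpa using key v hv
  · simpa using (Asymptotics.isLittleO_norm_pow_id (E' := E) one_lt_two)

/-- **Frobenius' theorem for linear connections.** If the rays issuing from `x₀` transport the
vectors of `N` into `N`, and the curvature of `dξ = A ξ` vanishes on `N`, then near `x₀` every
vector of `N x₀` extends to a smooth parallel section of `N`. -/
theorem exists_parallel_section [CompleteSpace F] {A : E → E →L[ℝ] F →L[ℝ] F} {S : Set E}
    (hS : IsOpen S) (hA : ContDiffOn ℝ ∞ A S) (N : E → Set F) {x₀ : E} (hx₀ : x₀ ∈ S)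
    (hN : ∀ (u : E) (y : ℝ → F), (∀ t ∈ Icc (0 : ℝ) 1, x₀ + t • u ∈ S) → y 0 ∈ N x₀ →
      (∀ t ∈ Icc (0 : ℝ) 1, HasDerivWithinAt y (A (x₀ + t • u) u (y t)) (Icc 0 1) t) →
      ∀ t ∈ Icc (0 : ℝ) 1, y t ∈ N (x₀ + t • u))
    (hflat : ∀ x ∈ S, ∀ y ∈ N x, ∀ u v,
      fderiv ℝ A x u v y + A x v (A x u y) = fderiv ℝ A x v u y + A x u (A x v y)) :
    ∃ r > 0, ball x₀ r ⊆ S ∧ ∀ y₀ ∈ N x₀, ∃ ξ : E → F, ξ x₀ = y₀ ∧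
      ContDiffOn ℝ ∞ ξ (ball x₀ r) ∧
      ∀ x ∈ ball x₀ r, ξ x ∈ N x ∧ HasFDerivAt ξ ((A x).flip (ξ x)) x := by
  obtain ⟨C, hC, r', hr', hsub, hdiff, hA0, hA1, hA2, hA3⟩ :=
    exists_taylor_bounds (hS.mem_nhds hx₀)
      ((hA.contDiffAt (hS.mem_nhds hx₀)).of_le (m := 2) ENat.LEInfty.out)
  -- on this ball the radial equations have coefficients of norm at most `1 / 2`
  set r : ℝ := min r' (1 / (2 * C)) with hrdef
  have hr : 0 < r := lt_min hr' (by positivity)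
  have hCr : C * r ≤ 1 / 2 := by
    calc C * r ≤ C * (1 / (2 * C)) := by gcongr; exact min_le_right _ _
      _ = 1 / 2 := by field_simp
  have hb : ball x₀ r ⊆ ball x₀ r' := ball_subset_ball (min_le_left _ _)
  have hmem : ∀ u : E, ‖u‖ < r → ∀ t ∈ Icc (0 : ℝ) 1, x₀ + t • u ∈ ball x₀ r := by
    intro u hu t ht
    rw [mem_ball_iff_norm, add_sub_cancel_left, norm_smul, Real.norm_of_nonneg ht.1]
    exact (mul_le_of_le_one_left (norm_nonneg _) ht.2).trans_lt hu
  refine ⟨r, hr, hb.trans hsub, fun y₀ hy₀ => ?_⟩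
  have hex : ∀ u : E, ∃ y : ℝ → F, ‖u‖ < r → y 0 = y₀ ∧ ∀ t ∈ Icc (0 : ℝ) 1,
      HasDerivWithinAt y (A (x₀ + t • u) u (y t)) (Icc 0 1) t := by
    intro u
    by_cases hu : ‖u‖ < r
    · obtain ⟨y, h⟩ := exists_solution_unitInterval (B := fun t => A (x₀ + t • u) u)
        (fun t ht => by
          have h1 : ContinuousAt A (x₀ + t • u) := (hdiff _ (hb (hmem u hu t ht))).continuousAt
          have h2 : ContinuousAt (fun t : ℝ => x₀ + t • u) t := by fun_prop
          exact ((ContinuousAt.comp (f := fun t : ℝ => x₀ + t • u) h1 h2).clm_apply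
            continuousAt_const).continuousWithinAt)
        (fun t ht => (ContinuousLinearMap.le_of_opNorm_le_of_le _
          (hA0 _ (hb (hmem u hu t ht))) hu.le).trans hCr) y₀
      exact ⟨y, fun _ => h⟩
    · exact ⟨0, fun h => absurd h hu⟩
  choose y hy using hex
  have hNy : ∀ u : E, ‖u‖ < r → ∀ t ∈ Icc (0 : ℝ) 1, y u t ∈ N (x₀ + t • u) := fun u hu =>
    hN u (y u) (fun t ht => hsub (hb (hmem u hu t ht))) (by rwa [(hy u hu).1]) (hy u hu).2
  have hder : ∀ x ∈ ball x₀ r,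
      HasFDerivAt (fun x => y (x - x₀) 1) ((A x).flip (y (x - x₀) 1)) x := by
    intro x hx
    have h := hasFDerivAt_of_radial_solutions hC hCr (fun x hx => hdiff x (hb hx))
      (fun x hx => hA0 x (hb hx)) (fun x hx => hA1 x (hb hx))
      (fun x hx z hz => hA2 x (hb hx) z (hb hz)) (fun x hx z hz => hA3 x (hb hx) z (hb hz))
      (fun u hu => (hy u hu).1) (fun u hu => (hy u hu).2)
      (fun u hu t ht v => hflat _ (hsub (hb (hmem u hu t ht))) _ (hNy u hu t ht) u v)
      (mem_ball_iff_norm.1 hx)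
    rw [add_sub_cancel] at h
    exact h.comp x ((hasFDerivAt_id x).sub_const x₀)
  refine ⟨fun x => y (x - x₀) 1, ?_, ?_, fun x hx => ⟨?_, hder x hx⟩⟩
  · -- the ray to `x₀` itself is constant
    have h0 : ‖(0 : E)‖ < r := by simpa using hr
    have := constant_of_has_deriv_right_zero (f := y 0) (a := 0) (b := 1)
      (fun t ht => ((hy 0 h0).2 t ht).continuousWithinAt)
      (fun t ht => by
        simpa using ((hy 0 h0).2 t (Ico_subset_Icc_self ht)).mono_of_mem_nhdsWithin
          (Icc_mem_nhdsGE_of_mem ht)) 1 (right_mem_Icc.2 zero_le_one)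
    simp [this, (hy 0 h0).1]
  · -- the equation expresses the derivative by `ξ` itself, which bootstraps its regularity
    have hAb : ContDiffOn ℝ ∞ A (ball x₀ r) := hA.mono (hb.trans hsub)
    rw [contDiffOn_infty]
    intro k
    induction k with
    | zero =>
      exact contDiffOn_zero.2 fun x hx => (hder x hx).continuousAt.continuousWithinAt
    | succ k ih =>
      have : ((k + 1 : ℕ) : WithTop ℕ∞) = (k : WithTop ℕ∞) + 1 := by push_cast; rfl
      rw [this, contDiffOn_succ_iff_fderiv_of_isOpen isOpen_ball]
      refine ⟨fun x hx => (hder x hx).differentiableAt.differentiableWithinAt,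
        fun h => absurd h (by simp), ?_⟩
      have hk : ContDiffOn ℝ k A (ball x₀ r) := hAb.of_le (by exact_mod_cast le_top)
      refine ContDiffOn.congr (f := fun x => (A x).flip (y (x - x₀) 1)) ?_
        fun x hx => (hder x hx).fderiv
      exact ((ContinuousLinearMap.flipₗᵢ ℝ E F F).toContinuousLinearEquiv.contDiff.comp_contDiffOn
        hk).clm_apply ih
  · have := hNy (x - x₀) (mem_ball_iff_norm.1 hx) 1 (right_mem_Icc.2 zero_le_one)
    rwa [one_smul, add_sub_cancel] at this

end Frobenius

/-! ### Parallel normal frames and normal curvature -/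

section NormalFrame

-- needed for the norm on iterated spaces of operators such as `E →L[ℝ] E →L[ℝ] F →L[ℝ] F`
set_option maxSynthPendingDepth 2
set_option linter.unusedSectionVars false

variable {E F : Type*} [NormedAddCommGroup E] [InnerProductSpace ℝ E] [FiniteDimensional ℝ E]
  [NormedAddCommGroup F] [InnerProductSpace ℝ F] [CompleteSpace F]

/-- The orthogonal projection of the ambient space onto the normal space of `g` at `x`. -/
def normalProj (g : E → F) (x : E) : F →L[ℝ] F :=
  ((LinearMap.range (fderiv ℝ g x : E →ₗ[ℝ] F))ᗮ).starProjection

lemma normalProj_apply_eq_self_iff {g : E → F} {x : E} {y : F} :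
    normalProj g x y = y ↔ y ∈ normalSpace g x :=
  Submodule.starProjection_eq_self_iff

lemma normalProj_apply_mem (g : E → F) (x : E) (y : F) : normalProj g x y ∈ normalSpace g x :=
  Submodule.starProjection_apply_mem (LinearMap.range (fderiv ℝ g x : E →ₗ[ℝ] F))ᗮ y

lemma normalProj_idem (g : E → F) (x : E) (y : F) :
    normalProj g x (normalProj g x y) = normalProj g x y :=
  normalProj_apply_eq_self_iff.2 (normalProj_apply_mem g x y)

lemma isUnit_adjoint_comp_self {B : E →L[ℝ] F} (hB : Function.Injective B) :
    IsUnit (B.adjoint ∘L B) := by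
  have : CompleteSpace E := FiniteDimensional.complete ℝ E
  rw [ContinuousLinearMap.isUnit_iff_bijective]
  have hinj : Function.Injective (B.adjoint ∘L B) := by
    rw [injective_iff_map_eq_zero]
    intro v hv
    apply (injective_iff_map_eq_zero B).1 hB
    have : inner ℝ (B.adjoint (B v)) v = 0 := by
      rw [show B.adjoint (B v) = 0 from hv, inner_zero_left]
    rwa [ContinuousLinearMap.adjoint_inner_left, inner_self_eq_zero] at this
  exact ⟨hinj, (LinearMap.injective_iff_surjective
    (f := ((B.adjoint ∘L B : E →L[ℝ] E) : E →ₗ[ℝ] E))).1 hinj⟩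

/-- The projection onto the orthogonal complement of the image of an injective map `B` is
`1 - B (B* B)⁻¹ B*`. -/
lemma starProjection_orthogonal_range {B : E →L[ℝ] F} (hB : Function.Injective B) :
    ((LinearMap.range (B : E →ₗ[ℝ] F))ᗮ).starProjection =
      ContinuousLinearMap.id ℝ F - B ∘L (Ring.inverse (B.adjoint ∘L B)) ∘L B.adjoint := by
  ext y
  set c := Ring.inverse (B.adjoint ∘L B) (B.adjoint y) with hc
  have hcc : B.adjoint (B c) = B.adjoint y := by
    have := Ring.mul_inverse_cancel _ (isUnit_adjoint_comp_self hB)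
    exact congrArg (fun L : E →L[ℝ] E => L (B.adjoint y)) this
  refine Submodule.eq_starProjection_of_mem_orthogonal ?_ ?_
  · rw [Submodule.mem_orthogonal]
    rintro _ ⟨w, rfl⟩
    change inner ℝ (B w) (y - B c) = 0
    rw [← ContinuousLinearMap.adjoint_inner_right, map_sub, hcc, sub_self, inner_zero_right]
  · apply Submodule.le_orthogonal_orthogonal
    refine ⟨c, ?_⟩
    change B c = y - (y - B c)
    abel

lemma contDiffOn_normalProj {g : E → F} {S : Set E} (hS : IsOpen S) (hg : IsImmersionOn g S) :
    ContDiffOn ℝ ∞ (normalProj g) S := by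
  have hd : ContDiffOn ℝ ∞ (fderiv ℝ g) S := hg.1.fderiv_of_isOpen hS le_rfl
  have had : ContDiffOn ℝ ∞ (fun x => (fderiv ℝ g x).adjoint) S :=
    (ContinuousLinearMap.adjoint (𝕜 := ℝ) (E := E) (F := F)).toContinuousLinearEquiv.contDiff
      |>.comp_contDiffOn hd
  refine ContDiffOn.congr (f := fun x => ContinuousLinearMap.id ℝ F - fderiv ℝ g x ∘L
    (Ring.inverse ((fderiv ℝ g x).adjoint ∘L fderiv ℝ g x)) ∘L (fderiv ℝ g x).adjoint) ?_
    fun x hx => starProjection_orthogonal_range (hg.2 x hx)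
  refine contDiffOn_const.sub (hd.clm_comp (ContDiffOn.clm_comp ?_ had))
  intro x hx
  obtain ⟨u, hu⟩ := isUnit_adjoint_comp_self (hg.2 x hx)
  have h := contDiffAt_ringInverse ℝ (n := ∞) u
  rw [hu] at h
  exact h.comp_contDiffWithinAt x ((had.clm_comp hd) x hx)

/-- `ζ` is a smooth orthonormal family of normal fields along `g` over `V` that are parallel for
the normal connection: their derivatives have no component along the family. -/
structure IsParallelNormalFrame {ι : Type*} (g : E → F) (ζ : ι → E → F) (V : Set E) : Prop where
  smooth : ∀ a, ContDiffOn ℝ ∞ (ζ a) V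
  orthonormal : ∀ x ∈ V, Orthonormal ℝ (fun a => ζ a x)
  normal : ∀ x ∈ V, ∀ a v, inner ℝ (ζ a x) (fderiv ℝ g x v) = 0
  parallel : ∀ x ∈ V, ∀ a b v, inner ℝ (ζ a x) (fderiv ℝ (ζ b) x v) = 0

variable {ι : Type*} [Fintype ι] {g : E → F} {ζ : ι → E → F} {V S : Set E}

lemma IsParallelNormalFrame.normalProj_apply [FiniteDimensional ℝ F]
    (h : IsParallelNormalFrame g ζ V)
    (hcard : Module.finrank ℝ E + Fintype.card ι = Module.finrank ℝ F) {x : E} (hx : x ∈ V)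
    (hinj : Function.Injective (fderiv ℝ g x)) (y : F) :
    normalProj g x y = ∑ a, inner ℝ (ζ a x) y • ζ a x := by
  classical
  have hmem : ∀ a, ζ a x ∈ (LinearMap.range (fderiv ℝ g x : E →ₗ[ℝ] F))ᗮ := by
    intro a
    rw [Submodule.mem_orthogonal']
    rintro _ ⟨v, rfl⟩
    exact h.normal x hx a v
  have hspan : Submodule.span ℝ (range fun a => ζ a x) =
      (LinearMap.range (fderiv ℝ g x : E →ₗ[ℝ] F))ᗮ := by
    refine Submodule.eq_of_le_of_finrank_eq (Submodule.span_le.2 ?_) ?_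
    · rintro _ ⟨a, rfl⟩
      exact hmem a
    · rw [finrank_span_eq_card (h.orthonormal x hx).linearIndependent]
      have h1 := Submodule.finrank_add_finrank_orthogonal
        (LinearMap.range (fderiv ℝ g x : E →ₗ[ℝ] F))
      have h2 := LinearMap.finrank_range_of_inj (f := (fderiv ℝ g x : E →ₗ[ℝ] F)) hinj
      omega
  refine Submodule.eq_starProjection_of_mem_orthogonal
    (Submodule.sum_mem _ fun a _ => Submodule.smul_mem _ _ (hmem a)) ?_
  rw [← hspan, Submodule.mem_orthogonal']
  intro w hw
  induction hw using Submodule.span_induction with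
  | mem w hw =>
    obtain ⟨b, rfl⟩ := hw
    rw [real_inner_comm, inner_sub_right, (h.orthonormal x hx).inner_right_fintype, sub_self]
  | zero => simp
  | add w z _ _ hw hz => rw [inner_add_right, hw, hz, add_zero]
  | smul c w _ hw => rw [inner_smul_right, hw, mul_zero]

/-- In a parallel orthonormal normal frame the normal connection is the flat derivative of the
coefficients. -/
lemma IsParallelNormalFrame.normalConnection_eq [FiniteDimensional ℝ F]
    (h : IsParallelNormalFrame g ζ V)
    (hcard : Module.finrank ℝ E + Fintype.card ι = Module.finrank ℝ F)
    (hinj : ∀ x ∈ S, Function.Injective (fderiv ℝ g x)) (hSV : S ⊆ V) {T : Set E} (hTS : T ⊆ S)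
    (hT : IsOpen T) {ξ : E → F} (hξ : DifferentiableOn ℝ ξ T)
    (hn : ∀ x ∈ T, ξ x ∈ normalSpace g x) (X : E → E) {x : E} (hx : x ∈ T) :
    normalConnection g X ξ x =
      ∑ a, fderiv ℝ (fun z => inner ℝ (ζ a z) (ξ z)) x (X x) • ζ a x := by
  have hxS := hTS hx
  have hxV := hSV hxS
  change normalProj g x (fderiv ℝ ξ x (X x)) = _
  rw [h.normalProj_apply hcard hxV (hinj x hxS)]
  refine Finset.sum_congr rfl fun a _ => ?_
  have hdζ : DifferentiableAt ℝ (ζ a) x :=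
    (((h.smooth a).mono (hTS.trans hSV)).contDiffAt (hT.mem_nhds hx)).differentiableAt (by simp)
  have hz : inner ℝ (fderiv ℝ (ζ a) x (X x)) (ξ x) = 0 := by
    rw [← normalProj_apply_eq_self_iff.2 (hn x hx), h.normalProj_apply hcard hxV (hinj x hxS),
      inner_sum]
    refine Finset.sum_eq_zero fun b _ => ?_
    rw [inner_smul_right, real_inner_comm (ζ b x), h.parallel x hxV, mul_zero]
  rw [fderiv_inner_apply ℝ hdζ (hξ.differentiableAt (hT.mem_nhds hx)), hz, add_zero]

/-- An immersion whose normal bundle is spanned by parallel fields has flat normal bundle. -/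
theorem IsParallelNormalFrame.flatNormalBundleOn [FiniteDimensional ℝ F]
    (h : IsParallelNormalFrame g ζ V)
    (hcard : Module.finrank ℝ E + Fintype.card ι = Module.finrank ℝ F)
    (hinj : ∀ x ∈ S, Function.Injective (fderiv ℝ g x)) (hSV : S ⊆ V) :
    FlatNormalBundleOn g S := by
  intro T hTS hT X Y ξ hX hY hξ hn x hx
  have hζ : ∀ a, ContDiffOn ℝ ∞ (ζ a) T := fun a => (h.smooth a).mono (hTS.trans hSV)
  have hh : ∀ a, ContDiffOn ℝ ∞ (fun z => inner ℝ (ζ a z) (ξ z)) T := fun a => (hζ a).inner ℝ hξ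
  have hone : ∀ Z : E → E, ∀ z ∈ T, normalConnection g Z ξ z =
      ∑ a, fderiv ℝ (fun z => inner ℝ (ζ a z) (ξ z)) z (Z z) • ζ a z := fun Z z hz =>
    h.normalConnection_eq hcard hinj hSV hTS hT (hξ.differentiableOn (by simp)) hn Z hz
  have htwo : ∀ Z W : E → E, ContDiffOn ℝ ∞ W T →
      normalConnection g Z (normalConnection g W ξ) x = ∑ a,
        (fderiv ℝ (fderiv ℝ fun z => inner ℝ (ζ a z) (ξ z)) x (Z x) (W x) +
          fderiv ℝ (fun z => inner ℝ (ζ a z) (ξ z)) x (fderiv ℝ W x (Z x))) • ζ a x := by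
    intro Z W hW
    have hdh : ∀ a, ContDiffOn ℝ ∞ (fderiv ℝ fun z => inner ℝ (ζ a z) (ξ z)) T := fun a =>
      (hh a).fderiv_of_isOpen hT le_rfl
    have hk : ∀ a, ContDiffOn ℝ ∞ (fun z => fderiv ℝ (fun z => inner ℝ (ζ a z) (ξ z)) z (W z)) T :=
      fun a => (hdh a).clm_apply hW
    have hη : ContDiffOn ℝ ∞ (normalConnection g W ξ) T :=
      (ContDiffOn.sum fun a _ => (hk a).smul (hζ a)).congr fun z hz => hone W z hz
    rw [h.normalConnection_eq hcard hinj hSV hTS hT (hη.differentiableOn (by simp))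
      (fun z _ => normalProj_apply_mem g z _) Z hx]
    refine Finset.sum_congr rfl fun a _ => ?_
    have hev : (fun z => inner ℝ (ζ a z) (normalConnection g W ξ z)) =ᶠ[𝓝 x]
        fun z => fderiv ℝ (fun z => inner ℝ (ζ a z) (ξ z)) z (W z) := by
      filter_upwards [hT.mem_nhds hx] with z hz
      rw [hone W z hz, (h.orthonormal z (hSV (hTS hz))).inner_right_fintype]
    rw [hev.fderiv_eq, fderiv_clm_apply
      (((hdh a).contDiffAt (hT.mem_nhds hx)).differentiableAt (by simp))
      ((hW.contDiffAt (hT.mem_nhds hx)).differentiableAt (by simp))]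
    congr 1
    simp [add_comm]
  rw [normalCurvature, htwo X Y hY, htwo Y X hX, hone _ x hx, ← Finset.sum_sub_distrib,
    ← Finset.sum_sub_distrib]
  refine Finset.sum_eq_zero fun a _ => ?_
  rw [((hh a).contDiffAt (hT.mem_nhds hx)).isSymmSndFDerivAt (by simp; exact ENat.LEInfty.out)
    (X x) (Y x), VectorField.lieBracket_eq, map_sub]
  module

lemma differentiableAt_normalProj (hS : IsOpen S) (hg : IsImmersionOn g S) {x : E} (hx : x ∈ S) :
    DifferentiableAt ℝ (normalProj g) x :=
  ((contDiffOn_normalProj hS hg).contDiffAt (hS.mem_nhds hx)).differentiableAt (by simp)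

/-- The Leibniz rule for `P² = P`, with `P` the normal projection. -/
lemma fderiv_normalProj_apply (hS : IsOpen S) (hg : IsImmersionOn g S) {x : E} (hx : x ∈ S)
    (u : E) (y : F) :
    fderiv ℝ (normalProj g) x u y = fderiv ℝ (normalProj g) x u (normalProj g x y) +
      normalProj g x (fderiv ℝ (normalProj g) x u y) := by
  have hP := (differentiableAt_normalProj hS hg hx).hasFDerivAt
  have h1 : HasFDerivAt (fun z => normalProj g z y)
      ((fderiv ℝ (normalProj g) x).flip y) x := by
    simpa using hP.clm_apply (hasFDerivAt_const y x)
  have h2 := hP.clm_apply h1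
  have h3 : (fun z => normalProj g z (normalProj g z y)) = fun z => normalProj g z y :=
    funext fun z => normalProj_idem g z y
  rw [h3] at h2
  have := congrArg (fun L : E →L[ℝ] F => L u) (h1.unique h2)
  simp only [ContinuousLinearMap.flip_apply, add_apply, ContinuousLinearMap.comp_apply] at this
  rw [add_comm]
  exact this

/-- The derivative of the normal projection maps normal vectors to tangent vectors. -/
lemma normalProj_fderiv_of_normal (hS : IsOpen S) (hg : IsImmersionOn g S) {x : E} (hx : x ∈ S)
    (u : E) {y : F} (hy : normalProj g x y = y) :
    normalProj g x (fderiv ℝ (normalProj g) x u y) = 0 := by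
  have h := fderiv_normalProj_apply hS hg hx u y
  rw [hy] at h
  exact left_eq_add.1 h

/-- The derivative of the normal projection maps tangent vectors to normal vectors. -/
lemma normalProj_fderiv_of_tangent (hS : IsOpen S) (hg : IsImmersionOn g S) {x : E} (hx : x ∈ S)
    (u : E) {y : F} (hy : normalProj g x y = 0) :
    normalProj g x (fderiv ℝ (normalProj g) x u y) = fderiv ℝ (normalProj g) x u y := by
  have h := fderiv_normalProj_apply hS hg hx u y
  rw [hy, map_zero, zero_add] at h
  exact h.symm

/-- **Ricci equation.** On normal vectors, the normal curvature is the commutator of the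
derivatives of the normal projection, so that a flat normal bundle makes them commute. -/
lemma FlatNormalBundleOn.fderiv_normalProj_comm (hS : IsOpen S) (hg : IsImmersionOn g S)
    (hflat : FlatNormalBundleOn g S) {x : E} (hx : x ∈ S) {y : F} (hy : normalProj g x y = y)
    (u v : E) :
    fderiv ℝ (normalProj g) x u (fderiv ℝ (normalProj g) x v y) =
      fderiv ℝ (normalProj g) x v (fderiv ℝ (normalProj g) x u y) := by
  have hPS := contDiffOn_normalProj hS hg
  have hdP : ContDiffOn ℝ ∞ (fderiv ℝ (normalProj g)) S := hPS.fderiv_of_isOpen hS le_rfl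
  have happ : ∀ z ∈ S, HasFDerivAt (fun z => normalProj g z y)
      ((fderiv ℝ (normalProj g) z).flip y) z := fun z hz => by
    simpa using (differentiableAt_normalProj hS hg hz).hasFDerivAt.clm_apply
      (hasFDerivAt_const y z)
  have htwo : ∀ u v : E, normalConnection g (fun _ => u)
      (normalConnection g (fun _ => v) fun z => normalProj g z y) x =
      fderiv ℝ (normalProj g) x u (fderiv ℝ (normalProj g) x v y) +
        normalProj g x (fderiv ℝ (fderiv ℝ (normalProj g)) x u v y) := by
    intro u v
    have hev : normalConnection g (fun _ => v) (fun z => normalProj g z y) =ᶠ[𝓝 x]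
        fun z => normalProj g z (fderiv ℝ (normalProj g) z v y) := by
      filter_upwards [hS.mem_nhds hx] with z hz
      change normalProj g z (fderiv ℝ (fun z => normalProj g z y) z v) = _
      rw [(happ z hz).fderiv, ContinuousLinearMap.flip_apply]
    have hd2 := ((hdP.contDiffAt (hS.mem_nhds hx)).differentiableAt (by simp)).hasFDerivAt
    have hd := (differentiableAt_normalProj hS hg hx).hasFDerivAt.clm_apply
      ((hd2.clm_apply (hasFDerivAt_const v x)).clm_apply (hasFDerivAt_const y x))
    change normalProj g x (fderiv ℝ (normalConnection g (fun _ => v) fun z => normalProj g z y)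
      x u) = _
    rw [hev.fderiv_eq, hd.fderiv]
    simp only [add_apply, ContinuousLinearMap.comp_apply, ContinuousLinearMap.flip_apply,
      zero_apply, map_zero, zero_add, map_add, normalProj_idem]
    rw [normalProj_fderiv_of_tangent hS hg hx u (normalProj_fderiv_of_normal hS hg hx v hy)]
    abel
  have h := hflat S subset_rfl hS (fun _ => u) (fun _ => v) (fun z => normalProj g z y)
    contDiffOn_const contDiffOn_const (hPS.clm_apply contDiffOn_const)
    (fun z _ => normalProj_apply_mem g z y) x hx
  have hbr : normalConnection g (VectorField.lieBracket ℝ (fun _ => u) fun _ => v)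
      (fun z => normalProj g z y) x = 0 := by
    change normalProj g x (fderiv ℝ _ x (VectorField.lieBracket ℝ (fun _ => u) (fun _ => v) x)) = 0
    simp [VectorField.lieBracket_eq]
  rw [normalCurvature, htwo, htwo, hbr, sub_zero,
    (hPS.contDiffAt (hS.mem_nhds hx)).isSymmSndFDerivAt (by simp; exact ENat.LEInfty.out) u v,
    add_sub_add_right_eq_sub] at h
  exact sub_eq_zero.1 h

/-- Radial solutions of `dξ = dP ξ` starting at a normal vector stay normal: the tangential part
`q = y - P y` solves a homogeneous linear equation, `q' = -(P dP) q`. -/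
lemma normalProj_eq_self_of_radial_solution (hS : IsOpen S) (hg : IsImmersionOn g S) {x₀ u : E}
    {y : ℝ → F} (hray : ∀ t ∈ Icc (0 : ℝ) 1, x₀ + t • u ∈ S)
    (h0 : normalProj g x₀ (y 0) = y 0)
    (hy : ∀ t ∈ Icc (0 : ℝ) 1, HasDerivWithinAt y
      (fderiv ℝ (normalProj g) (x₀ + t • u) u (y t)) (Icc 0 1) t) {t : ℝ}
    (ht : t ∈ Icc (0 : ℝ) 1) :
    normalProj g (x₀ + t • u) (y t) = y t := by
  have hPS := contDiffOn_normalProj hS hg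
  have hdP : ContDiffOn ℝ ∞ (fderiv ℝ (normalProj g)) S := hPS.fderiv_of_isOpen hS le_rfl
  have hline : ContinuousOn (fun t : ℝ => x₀ + t • u) (Icc 0 1) := by fun_prop
  obtain ⟨K, hK⟩ := isCompact_Icc.exists_bound_of_continuousOn
    (((hPS.continuousOn.comp hline hray)).clm_comp
      ((hdP.continuousOn.comp hline hray).clm_apply (continuousOn_const (c := u))))
  have hder : ∀ t ∈ Icc (0 : ℝ) 1, HasDerivWithinAt
      (fun t => y t - normalProj g (x₀ + t • u) (y t))
      (-(normalProj g (x₀ + t • u) (fderiv ℝ (normalProj g) (x₀ + t • u) u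
        (y t - normalProj g (x₀ + t • u) (y t))))) (Icc 0 1) t := by
    intro t ht
    have hl : HasDerivWithinAt (fun t : ℝ => x₀ + t • u) u (Icc 0 1) t := by
      simpa using ((hasDerivWithinAt_id t (Icc (0 : ℝ) 1)).smul_const u).const_add x₀
    have hPt : HasDerivWithinAt (fun t : ℝ => normalProj g (x₀ + t • u))
        (fderiv ℝ (normalProj g) (x₀ + t • u) u) (Icc 0 1) t :=
      HasFDerivAt.comp_hasDerivWithinAt (f := fun t : ℝ => x₀ + t • u) t
        (differentiableAt_normalProj hS hg (hray t ht)).hasFDerivAt hl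
    refine ((hy t ht).sub (hPt.clm_apply (hy t ht))).congr_deriv ?_
    have h1 := normalProj_fderiv_of_normal hS hg (hray t ht) u
      (normalProj_idem g (x₀ + t • u) (y t))
    rw [map_sub, map_sub, h1]
    abel
  have := eq_zero_of_abs_deriv_le_mul_abs_self_of_eq_zero_right (K := K)
    (fun t ht => (hder t ht).continuousWithinAt)
    (fun t ht => (hder t (Ico_subset_Icc_self ht)).mono_of_mem_nhdsWithin
      (Icc_mem_nhdsGE_of_mem ht))
    (by simp [h0])
    (fun t ht => by
      rw [norm_neg]
      exact ContinuousLinearMap.le_of_opNorm_le_of_le (normalProj g (x₀ + t • u) ∘L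
        fderiv ℝ (normalProj g) (x₀ + t • u) u) (hK t (Ico_subset_Icc_self ht)) le_rfl)
    t ht
  exact (sub_eq_zero.1 this).symm

/-- An immersion with flat normal bundle has a parallel normal frame near every point, with any
prescribed orthonormal value there. -/
theorem FlatNormalBundleOn.exists_parallelNormalFrame (hS : IsOpen S) (hg : IsImmersionOn g S)
    (hflat : FlatNormalBundleOn g S) {x₀ : E} (hx₀ : x₀ ∈ S) {ι : Type*} {b : ι → F}
    (hb : Orthonormal ℝ b) (hbn : ∀ a, b a ∈ normalSpace g x₀) :
    ∃ r > 0, ball x₀ r ⊆ S ∧ ∃ ζ : ι → E → F, (∀ a, ζ a x₀ = b a) ∧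
      IsParallelNormalFrame g ζ (ball x₀ r) := by
  have hPS := contDiffOn_normalProj hS hg
  have hdP : ContDiffOn ℝ ∞ (fderiv ℝ (normalProj g)) S := hPS.fderiv_of_isOpen hS le_rfl
  obtain ⟨r, hr, hsub, hex⟩ := exists_parallel_section hS hdP
    (fun x => {y | normalProj g x y = y}) hx₀
    (fun u y hray h0 hy t ht => normalProj_eq_self_of_radial_solution hS hg hray h0 hy ht)
    (fun x hx y hy u v => by
      rw [(hPS.contDiffAt (hS.mem_nhds hx)).isSymmSndFDerivAt (by simp; exact ENat.LEInfty.out)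
        u v, hflat.fderiv_normalProj_comm hS hg hx hy v u])
  choose! ξ hξ0 hξs hξ using hex
  have hbN : ∀ a, b a ∈ {y | normalProj g x₀ y = y} := fun a =>
    normalProj_apply_eq_self_iff.2 (hbn a)
  have hpar : ∀ x ∈ ball x₀ r, ∀ a c v, inner ℝ (ξ (b a) x) (fderiv ℝ (ξ (b c)) x v) = 0 := by
    intro x hx a c v
    obtain ⟨ha, -⟩ := hξ (b a) (hbN a) x hx
    obtain ⟨hc, hcd⟩ := hξ (b c) (hbN c) x hx
    rw [hcd.fderiv, ContinuousLinearMap.flip_apply, ← show normalProj g x (ξ (b a) x) = _ from ha,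
      normalProj, Submodule.inner_starProjection_left_eq_right]
    change inner ℝ _ (normalProj g x _) = 0
    rw [normalProj_fderiv_of_normal hS hg (hsub hx) v hc, inner_zero_right]
  have hdiff : ∀ a, DifferentiableOn ℝ (ξ (b a)) (ball x₀ r) := fun a =>
    (hξs (b a) (hbN a)).differentiableOn (by simp)
  refine ⟨r, hr, hsub, fun a => ξ (b a), fun a => hξ0 (b a) (hbN a),
    fun a => hξs (b a) (hbN a), fun x hx => ?_, fun x hx a v => ?_, hpar⟩
  · have hconst : ∀ a c, inner ℝ (ξ (b a) x) (ξ (b c) x) = inner ℝ (b a) (b c) := by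
      intro a c
      have := isOpen_ball.is_const_of_fderiv_eq_zero (𝕜 := ℝ) (convex_ball x₀ r).isPreconnected
        ((hdiff a).inner ℝ (hdiff c))
        (fun z hz => by
          ext v
          rw [fderiv_inner_apply ℝ ((hdiff a).differentiableAt (isOpen_ball.mem_nhds hz))
            ((hdiff c).differentiableAt (isOpen_ball.mem_nhds hz)), hpar z hz,
            real_inner_comm, hpar z hz]
          simp) hx (mem_ball_self hr)
      rw [this, hξ0 _ (hbN a), hξ0 _ (hbN c)]
    classical
    rw [orthonormal_iff_ite] at hb ⊢
    intro a c
    rw [hconst, hb]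
  · have := normalProj_apply_eq_self_iff.1 (hξ (b a) (hbN a) x hx).1
    exact (Submodule.mem_orthogonal' _ _).1 this _ ⟨v, rfl⟩

end NormalFrame

/-! ### Hessians and closed forms -/

section Hessian

variable {n : ℕ} {φ ψ : R n → ℝ} {V : Set (R n)} {x : R n}

lemma inner_gradient_eq_fderiv (φ : R n → ℝ) (x v : R n) :
    inner ℝ (gradient φ x) v = fderiv ℝ φ x v :=
  InnerProductSpace.toDual_symm_apply

lemma contDiffOn_gradient (hV : IsOpen V) (hφ : ContDiffOn ℝ ∞ φ V) :
    ContDiffOn ℝ ∞ (gradient φ) V :=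
  (InnerProductSpace.toDual ℝ (R n)).symm.toContinuousLinearEquiv.contDiff.comp_contDiffOn
    (hφ.fderiv_of_isOpen hV le_rfl)

lemma contDiffOn_hess (hV : IsOpen V) (hφ : ContDiffOn ℝ ∞ φ V) : ContDiffOn ℝ ∞ (hess φ) V :=
  (contDiffOn_gradient hV hφ).fderiv_of_isOpen hV le_rfl

lemma inner_hess_eq (hV : IsOpen V) (hφ : ContDiffOn ℝ ∞ φ V) (hx : x ∈ V) (u v : R n) :
    inner ℝ (hess φ x u) v = fderiv ℝ (fderiv ℝ φ) x u v := by
  have h1 := (((contDiffOn_gradient hV hφ).contDiffAt (hV.mem_nhds hx)).differentiableAt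
    (by simp)).hasFDerivAt.inner ℝ (hasFDerivAt_const v x)
  have h2 := ((((hφ.fderiv_of_isOpen hV le_rfl).contDiffAt (hV.mem_nhds hx)).differentiableAt
    (by simp : (∞ : WithTop ℕ∞) ≠ 0)).hasFDerivAt).clm_apply (hasFDerivAt_const v x)
  simp only [inner_gradient_eq_fderiv] at h1
  simpa [hess] using congrArg (fun L : R n →L[ℝ] ℝ => L u) (h1.unique h2)

lemma inner_hess_comm (hV : IsOpen V) (hφ : ContDiffOn ℝ ∞ φ V) (hx : x ∈ V) (u v : R n) :
    inner ℝ (hess φ x u) v = inner ℝ u (hess φ x v) := by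
  rw [inner_hess_eq hV hφ hx, real_inner_comm, inner_hess_eq hV hφ hx,
    (hφ.contDiffAt (hV.mem_nhds hx)).isSymmSndFDerivAt (by simp; exact ENat.LEInfty.out) u v]

lemma hess_mul_comm_iff (hV : IsOpen V) (hφ : ContDiffOn ℝ ∞ φ V) (hψ : ContDiffOn ℝ ∞ ψ V)
    (hx : x ∈ V) :
    hess φ x * hess ψ x = hess ψ x * hess φ x ↔
      ∀ u v, inner ℝ (hess φ x u) (hess ψ x v) = inner ℝ (hess φ x v) (hess ψ x u) := by
  have key : ∀ u v, inner ℝ (hess φ x u) (hess ψ x v) = inner ℝ (hess φ x v) (hess ψ x u) ↔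
      inner ℝ ((hess ψ x * hess φ x) u) v = inner ℝ ((hess φ x * hess ψ x) u) v := by
    intro u v
    rw [← inner_hess_comm hV hψ hx, inner_hess_comm hV hφ hx v, real_inner_comm _ v]
    rfl
  simp only [key]
  refine ⟨fun h u v => by rw [h], fun h => ?_⟩
  ext1 u
  exact (ext_inner_right ℝ (h u)).symm

/-- The `1`-form `v ↦ ⟪∇φ, (Hess ψ) v⟫`, an entry of `𝒢ᵗ d𝒢`. -/
def hessForm (φ ψ : R n → ℝ) (x : R n) : R n →L[ℝ] ℝ :=
  innerSL ℝ (gradient φ x) ∘L hess ψ x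

lemma contDiffOn_hessForm (hV : IsOpen V) (hφ : ContDiffOn ℝ ∞ φ V) (hψ : ContDiffOn ℝ ∞ ψ V) :
    ContDiffOn ℝ ∞ (hessForm φ ψ) V :=
  ((innerSL ℝ).contDiff.comp_contDiffOn (contDiffOn_gradient hV hφ)).clm_comp
    (contDiffOn_hess hV hψ)

/-- The form `⟪∇φ, (Hess ψ) ·⟫` is closed exactly where the Hessians of `φ` and `ψ` commute. -/
lemma fderiv_hessForm_symm_iff (hV : IsOpen V) (hφ : ContDiffOn ℝ ∞ φ V)
    (hψ : ContDiffOn ℝ ∞ ψ V) (hx : x ∈ V) :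
    (∀ u v, fderiv ℝ (hessForm φ ψ) x u v = fderiv ℝ (hessForm φ ψ) x v u) ↔
      hess φ x * hess ψ x = hess ψ x * hess φ x := by
  have key : ∀ u v, fderiv ℝ (hessForm φ ψ) x u v =
      inner ℝ (gradient φ x) (fderiv ℝ (hess ψ) x u v) +
        inner ℝ (hess φ x u) (hess ψ x v) := by
    intro u v
    have h1 : HasFDerivAt (fun z => hessForm φ ψ z v)
        ((fderiv ℝ (hessForm φ ψ) x).flip v) x := by
      simpa using (((contDiffOn_hessForm hV hφ hψ).contDiffAt (hV.mem_nhds hx)).differentiableAt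
        (by simp)).hasFDerivAt.clm_apply (hasFDerivAt_const v x)
    have h2 := (((contDiffOn_gradient hV hφ).contDiffAt (hV.mem_nhds hx)).differentiableAt
      (by simp)).hasFDerivAt.inner ℝ
      ((((contDiffOn_hess hV hψ).contDiffAt (hV.mem_nhds hx)).differentiableAt
        (by simp)).hasFDerivAt.clm_apply (hasFDerivAt_const v x))
    simpa [hess] using congrArg (fun L : R n →L[ℝ] ℝ => L u) (h1.unique h2)
  have hsymm := ((contDiffOn_gradient hV hψ).contDiffAt (hV.mem_nhds hx)).isSymmSndFDerivAt
    (by simp; exact ENat.LEInfty.out)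
  rw [hess_mul_comm_iff hV hφ hψ hx]
  refine forall₂_congr fun u v => ?_
  rw [key, key, show fderiv ℝ (hess ψ) x u v = fderiv ℝ (hess ψ) x v u from hsymm u v,
    add_right_inj]

end Hessian

/-! ### Calculus of matrix-valued maps -/

section MatrixCalculus

variable {n : ℕ} {ι κ μ : Type*}

/-- The differential `du(v)` at `x` of a vector-valued map `u`, taken entrywise. -/
def dVec (u : R n → κ → ℝ) (x v : R n) : κ → ℝ := fun a => fderiv ℝ (fun y => u y a) x v

lemma dMatrix_mul [Fintype κ] {A : R n → Matrix ι κ ℝ} {B : R n → Matrix κ μ ℝ} {x : R n}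
    (hA : ∀ a b, DifferentiableAt ℝ (fun y => A y a b) x)
    (hB : ∀ a b, DifferentiableAt ℝ (fun y => B y a b) x) (v : R n) :
    dMatrix (fun y => A y * B y) x v = dMatrix A x v * B x + A x * dMatrix B x v := by
  ext a b
  simp only [dMatrix, Matrix.of_apply, Matrix.add_apply, Matrix.mul_apply]
  rw [fderiv_fun_sum fun k _ => (hA a k).fun_mul (hB k b), ← Finset.sum_add_distrib, sum_apply]
  refine Finset.sum_congr rfl fun k _ => ?_
  rw [fderiv_fun_mul (hA a k) (hB k b)]
  simp only [add_apply, smul_apply, smul_eq_mul]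
  ring

lemma dVec_mulVec [Fintype κ] {A : R n → Matrix ι κ ℝ} {u : R n → κ → ℝ} {x : R n}
    (hA : ∀ a b, DifferentiableAt ℝ (fun y => A y a b) x)
    (hu : ∀ a, DifferentiableAt ℝ (fun y => u y a) x) (v : R n) :
    dVec (fun y => A y *ᵥ u y) x v = dMatrix A x v *ᵥ u x + A x *ᵥ dVec u x v := by
  ext a
  simp only [dVec, dMatrix, Matrix.mulVec, dotProduct, Pi.add_apply, Matrix.of_apply]
  rw [fderiv_fun_sum fun k _ => (hA a k).fun_mul (hu k), ← Finset.sum_add_distrib, sum_apply]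
  refine Finset.sum_congr rfl fun k _ => ?_
  rw [fderiv_fun_mul (hA a k) (hu k)]
  simp only [add_apply, smul_apply, smul_eq_mul]
  ring

lemma dMatrix_sub {A B : R n → Matrix ι κ ℝ} {x : R n}
    (hA : ∀ a b, DifferentiableAt ℝ (fun y => A y a b) x)
    (hB : ∀ a b, DifferentiableAt ℝ (fun y => B y a b) x) (v : R n) :
    dMatrix (fun y => A y - B y) x v = dMatrix A x v - dMatrix B x v := by
  ext a b
  simp [dMatrix, fderiv_fun_sub (hA a b) (hB a b)]

lemma dMatrix_const (A : Matrix ι κ ℝ) (x v : R n) : dMatrix (fun _ => A) x v = 0 := by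
  ext a b
  simp [dMatrix]

lemma dMatrix_congr {A B : R n → Matrix ι κ ℝ} {x : R n} (h : A =ᶠ[𝓝 x] B) (v : R n) :
    dMatrix A x v = dMatrix B x v := by
  ext a b
  have : (fun y => A y a b) =ᶠ[𝓝 x] fun y => B y a b := by
    filter_upwards [h] with y hy
    rw [hy]
  simp [dMatrix, this.fderiv_eq]

lemma dVec_add {u w : R n → κ → ℝ} {x : R n} (hu : ∀ a, DifferentiableAt ℝ (fun y => u y a) x)
    (hw : ∀ a, DifferentiableAt ℝ (fun y => w y a) x) (v : R n) :
    dVec (fun y => u y + w y) x v = dVec u x v + dVec w x v := by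
  ext a
  simp [dVec, fderiv_fun_add (hu a) (hw a)]

lemma dVec_sub {u w : R n → κ → ℝ} {x : R n} (hu : ∀ a, DifferentiableAt ℝ (fun y => u y a) x)
    (hw : ∀ a, DifferentiableAt ℝ (fun y => w y a) x) (v : R n) :
    dVec (fun y => u y - w y) x v = dVec u x v - dVec w x v := by
  ext a
  simp [dVec, fderiv_fun_sub (hu a) (hw a)]

lemma dVec_congr {u w : R n → κ → ℝ} {x : R n} (h : u =ᶠ[𝓝 x] w) (v : R n) :
    dVec u x v = dVec w x v := by
  ext a
  have : (fun y => u y a) =ᶠ[𝓝 x] fun y => w y a := by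
    filter_upwards [h] with y hy
    rw [hy]
  simp [dVec, this.fderiv_eq]

lemma dVec_ofLp (x v : R n) : dVec (fun y : R n => y.ofLp) x v = v.ofLp := by
  ext k
  exact congrArg (fun L : R n →L[ℝ] ℝ => L v) (EuclideanSpace.proj (𝕜 := ℝ) k).fderiv

/-- The entries of the derivative of a map into a Euclidean space. -/
lemma fderiv_ofLp_apply [Fintype ι] {g : R n → EuclideanSpace ℝ ι} {x : R n}
    (hg : DifferentiableAt ℝ g x) (v : R n) (s : ι) :
    (fderiv ℝ g x v) s = fderiv ℝ (fun y => g y s) x v := by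
  have h := (EuclideanSpace.proj (𝕜 := ℝ) s).hasFDerivAt.comp x hg.hasFDerivAt
  exact (congrArg (fun L : R n →L[ℝ] ℝ => L v) h.fderiv).symm

variable {E : Type*} [NormedAddCommGroup E] [NormedSpace ℝ E] {V : Set E}

lemma contDiffOn_matrix_mul [Fintype κ] {A : E → Matrix ι κ ℝ} {B : E → Matrix κ μ ℝ}
    (hA : ∀ a b, ContDiffOn ℝ ∞ (fun y => A y a b) V)
    (hB : ∀ a b, ContDiffOn ℝ ∞ (fun y => B y a b) V) (a : ι) (b : μ) :
    ContDiffOn ℝ ∞ (fun y => (A y * B y) a b) V := by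
  simp only [Matrix.mul_apply]
  exact ContDiffOn.sum fun k _ => (hA a k).mul (hB k b)

lemma contDiffOn_matrix_mulVec [Fintype κ] {A : E → Matrix ι κ ℝ} {u : E → κ → ℝ}
    (hA : ∀ a b, ContDiffOn ℝ ∞ (fun y => A y a b) V)
    (hu : ∀ a, ContDiffOn ℝ ∞ (fun y => u y a) V) (a : ι) :
    ContDiffOn ℝ ∞ (fun y => (A y *ᵥ u y) a) V := by
  simp only [Matrix.mulVec, dotProduct]
  exact ContDiffOn.sum fun k _ => (hA a k).mul (hu k)

variable [Fintype ι] [DecidableEq ι]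

lemma contDiffOn_matrix_det {A : E → Matrix ι ι ℝ}
    (hA : ∀ a b, ContDiffOn ℝ ∞ (fun y => A y a b) V) :
    ContDiffOn ℝ ∞ (fun y => (A y).det) V := by
  simp only [Matrix.det_apply]
  exact ContDiffOn.sum fun σ _ => (contDiffOn_prod fun k _ => hA _ k).const_smul _

lemma contDiffOn_matrix_inv {A : E → Matrix ι ι ℝ}
    (hA : ∀ a b, ContDiffOn ℝ ∞ (fun y => A y a b) V) (hu : ∀ x ∈ V, IsUnit (A x)) (a b : ι) :
    ContDiffOn ℝ ∞ (fun y => (A y)⁻¹ a b) V := by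
  simp only [Matrix.inv_def, Ring.inverse_eq_inv', Matrix.smul_apply, smul_eq_mul,
    Matrix.adjugate_apply]
  refine ((contDiffOn_matrix_det hA).inv fun x hx =>
    ((Matrix.isUnit_iff_isUnit_det _).1 (hu x hx)).ne_zero).mul (contDiffOn_matrix_det ?_)
  intro c d
  by_cases hc : c = b
  · subst hc
    simp only [Matrix.updateRow_self]
    exact contDiffOn_const
  · simp only [Matrix.updateRow_ne hc]
    exact hA c d

end MatrixCalculus

/-! ### Existence of `Ω` -/

section Adapted

variable {n m : ℕ} {φ : Fin m → R n → ℝ} {V : Set (R n)} {x : R n}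

lemma inner_R_eq_dotProduct (u v : R n) : inner ℝ u v = u.ofLp ⬝ᵥ v.ofLp := by
  rw [real_inner_comm, EuclideanSpace.inner_eq_star_dotProduct, star_trivial]

lemma dVec_eq_gradMatrix_transpose_mulVec (φ : Fin m → R n → ℝ) (x v : R n) :
    dVec (fun y i => φ i y) x v = (gradMatrix φ x)ᵀ *ᵥ v.ofLp := by
  ext i
  change fderiv ℝ (φ i) x v = (gradient (φ i) x).ofLp ⬝ᵥ v.ofLp
  rw [← inner_gradient_eq_fderiv, inner_R_eq_dotProduct]

lemma contDiffOn_gradMatrix (hV : IsOpen V) (hφ : ∀ i, ContDiffOn ℝ ∞ (φ i) V) (k : Fin n)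
    (i : Fin m) : ContDiffOn ℝ ∞ (fun y => gradMatrix φ y k i) V :=
  (EuclideanSpace.proj (𝕜 := ℝ) k).contDiff.comp_contDiffOn (contDiffOn_gradient hV (hφ i))

lemma dMatrix_gradMatrix_apply (hV : IsOpen V) (hφ : ∀ i, ContDiffOn ℝ ∞ (φ i) V) (hx : x ∈ V)
    (v : R n) (k : Fin n) (i : Fin m) :
    dMatrix (gradMatrix φ) x v k i = hess (φ i) x v k :=
  (fderiv_ofLp_apply (((contDiffOn_gradient hV (hφ i)).contDiffAt
    (hV.mem_nhds hx)).differentiableAt (by simp)) v k).symm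

lemma gradMatrix_transpose_mul_dMatrix_apply (hV : IsOpen V)
    (hφ : ∀ i, ContDiffOn ℝ ∞ (φ i) V) (hx : x ∈ V) (v : R n) (i j : Fin m) :
    ((gradMatrix φ x)ᵀ * dMatrix (gradMatrix φ) x v) i j = hessForm (φ i) (φ j) x v := by
  change _ = inner ℝ (gradient (φ i) x) (hess (φ j) x v)
  rw [inner_R_eq_dotProduct, Matrix.mul_apply]
  refine Finset.sum_congr rfl fun k _ => ?_
  rw [dMatrix_gradMatrix_apply hV hφ hx]
  rfl

lemma gradMatrix_transpose_mul_self_apply (φ : Fin m → R n → ℝ) (x : R n) (i j : Fin m) :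
    ((gradMatrix φ x)ᵀ * gradMatrix φ x) i j =
      inner ℝ (gradient (φ i) x) (gradient (φ j) x) := by
  rw [inner_R_eq_dotProduct]
  rfl

/-- The symmetric part of `Ω` being positive definite, `Ω` is invertible. -/
lemma isUnit_of_add_transpose_eq {Ω : Matrix (Fin m) (Fin m) ℝ} {G : Matrix (Fin n) (Fin m) ℝ}
    (h : Ω + Ωᵀ = Gᵀ * G + 1) : IsUnit Ω := by
  rw [← Matrix.mulVec_injective_iff_isUnit]
  rw [← Matrix.coe_mulVecLin, injective_iff_map_eq_zero]
  intro w hw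
  rw [Matrix.mulVecLin_apply] at hw
  have h1 : w ⬝ᵥ ((Ω + Ωᵀ) *ᵥ w) = 0 := by
    rw [Matrix.add_mulVec, hw, zero_add, Matrix.dotProduct_mulVec, Matrix.vecMul_transpose, hw,
      zero_dotProduct]
  rw [h, Matrix.add_mulVec, Matrix.one_mulVec, ← Matrix.mulVec_mulVec, dotProduct_add,
    Matrix.dotProduct_mulVec, Matrix.vecMul_transpose] at h1
  have h2 : 0 ≤ (G *ᵥ w) ⬝ᵥ (G *ᵥ w) := by simpa using dotProduct_star_self_nonneg (G *ᵥ w)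
  have h3 : 0 ≤ w ⬝ᵥ w := by simpa using dotProduct_star_self_nonneg w
  exact dotProduct_self_eq_zero.1 (by linarith)

/-- On a ball, the closed forms `⟪∇φ_i, (Hess φ_j) ·⟫` have primitives; the integration constants
can be chosen so that the symmetric part of `Ω` is `(𝒢ᵗ𝒢 + I) / 2` at the centre, hence
everywhere. -/
theorem exists_isAdapted_ball {r : ℝ} (h : CommutingHessiansOn φ (ball x r)) :
    ∃ Ω : R n → Matrix (Fin m) (Fin m) ℝ, IsAdapted φ Ω (ball x r) := by
  rcases le_or_gt r 0 with hr | hr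
  · rw [ball_eq_empty.2 hr]
    exact ⟨0, fun _ _ => contDiffOn_const, by simp, by simp, by simp⟩
  have hx := mem_ball_self (x := x) hr
  have hsm : ∀ i j, ContDiffOn ℝ ∞ (hessForm (φ i) (φ j)) (ball x r) := fun i j =>
    contDiffOn_hessForm isOpen_ball (h.1 i) (h.1 j)
  have hex : ∀ i j, ∃ p : R n → ℝ, ∀ y ∈ ball x r,
      HasFDerivAt p (hessForm (φ i) (φ j) y) y := fun i j =>
    (convex_ball x r).exists_forall_hasFDerivAt_of_fderiv_symmetric isOpen_ball
      ((hsm i j).differentiableOn (by simp)) fun y hy =>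
        (fderiv_hessForm_symm_iff isOpen_ball (h.1 i) (h.1 j) hy).2 (h.2 y hy i j)
  choose p hp using hex
  set S : Matrix (Fin m) (Fin m) ℝ := (gradMatrix φ x)ᵀ * gradMatrix φ x + 1 with hS
  have hSt : ∀ i j, S i j = S j i := fun i j => by
    have : Sᵀ = S := by simp [hS, Matrix.transpose_mul]
    rw [← this, Matrix.transpose_apply, this]
  set Ω : R n → Matrix (Fin m) (Fin m) ℝ := fun y =>
    Matrix.of fun i j => p i j y + (S i j / 2 - p i j x) with hΩ
  have hd : ∀ i j, ∀ y ∈ ball x r,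
      HasFDerivAt (fun y => Ω y i j) (hessForm (φ i) (φ j) y) y := fun i j y hy =>
    (hp i j y hy).add_const _
  have hsum : ∀ y ∈ ball x r, Ω y + (Ω y)ᵀ = (gradMatrix φ y)ᵀ * gradMatrix φ y + 1 := by
    intro y hy
    ext i j
    -- both sides have the same derivative and agree at the centre
    have hgr : ∀ i, ∀ z ∈ ball x r, HasFDerivAt (gradient (φ i)) (hess (φ i) z) z :=
      fun i z hz => (((contDiffOn_gradient isOpen_ball (h.1 i)).contDiffAt
        (isOpen_ball.mem_nhds hz)).differentiableAt (by simp)).hasFDerivAt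
    have hz : ∀ z ∈ ball x r, HasFDerivAt (fun z => Ω z i j + Ω z j i -
        inner ℝ (gradient (φ i) z) (gradient (φ j) z)) (0 : R n →L[ℝ] ℝ) z := by
      intro z hz
      refine (((hd i j z hz).add (hd j i z hz)).sub
        ((hgr i z hz).inner ℝ (hgr j z hz))).congr_fderiv ?_
      ext v
      simp [hessForm, add_comm]
    have := isOpen_ball.is_const_of_fderiv_eq_zero (𝕜 := ℝ) (convex_ball x r).isPreconnected
      (fun z hz' => (hz z hz').differentiableAt.differentiableWithinAt)
      (fun z hz' => (hz z hz').fderiv) hy hx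
    simp only [Matrix.add_apply, Matrix.transpose_apply, gradMatrix_transpose_mul_self_apply]
    have hx2 : Ω x i j + Ω x j i = S i j := by
      simp only [hΩ, Matrix.of_apply, hSt j i]
      ring
    rw [hx2, hS, Matrix.add_apply, gradMatrix_transpose_mul_self_apply] at this
    linarith
  refine ⟨Ω, fun i j => ?_, fun y hy => isUnit_of_add_transpose_eq (hsum y hy),
    fun y hy v => ?_, hsum⟩
  · rw [contDiffOn_infty_iff_fderiv_of_isOpen isOpen_ball]
    exact ⟨fun y hy => (hd i j y hy).differentiableAt.differentiableWithinAt,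
      (hsm i j).congr fun y hy => (hd i j y hy).fderiv⟩
  · ext i j
    rw [gradMatrix_transpose_mul_dMatrix_apply isOpen_ball h.1 hy]
    exact congrArg (fun L : R n →L[ℝ] ℝ => L v) (hd i j y hy).fderiv

end Adapted

/-! ### Blocks of vectors and frames in `ℝ^n ⊕ ℝ^m` -/

section Blocks

variable {n m : ℕ} {V : Set (R n)} {x : R n}

/-- The component in `ℝ^n` of a vector of `ℝ^n ⊕ ℝ^m`. -/
def fstPart (y : RR n m) : Fin n → ℝ := fun k => y (Sum.inl k)

/-- The component in `ℝ^m` of a vector of `ℝ^n ⊕ ℝ^m`. -/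
def sndPart (y : RR n m) : Fin m → ℝ := fun j => y (Sum.inr j)

/-- The `ℝ^n`-block of the matrix whose columns are the vectors `ζ i`. -/
def fstBlock (ζ : Fin m → RR n m) : Matrix (Fin n) (Fin m) ℝ := Matrix.of fun k i => fstPart (ζ i) k

/-- The `ℝ^m`-block of the matrix whose columns are the vectors `ζ i`. -/
def sndBlock (ζ : Fin m → RR n m) : Matrix (Fin m) (Fin m) ℝ := Matrix.of fun j i => sndPart (ζ i) j

lemma RR_ext {y z : RR n m} (h₁ : fstPart y = fstPart z) (h₂ : sndPart y = sndPart z) :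
    y = z := by
  ext s
  cases s with
  | inl k => exact congrFun h₁ k
  | inr j => exact congrFun h₂ j

lemma inner_RR_eq (y z : RR n m) :
    inner ℝ y z = fstPart y ⬝ᵥ fstPart z + sndPart y ⬝ᵥ sndPart z := by
  rw [real_inner_comm, EuclideanSpace.inner_eq_star_dotProduct, star_trivial]
  exact Fintype.sum_sum_type _

lemma orthonormal_iff_blocks (ζ : Fin m → RR n m) :
    Orthonormal ℝ ζ ↔
      (fstBlock ζ)ᵀ * fstBlock ζ + (sndBlock ζ)ᵀ * sndBlock ζ = 1 := by
  rw [orthonormal_iff_ite, ← Matrix.ext_iff]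
  refine forall₂_congr fun i j => ?_
  rw [inner_RR_eq, Matrix.one_apply]
  rfl

lemma forall_inner_eq_zero_iff_blocks (ζ : Fin m → RR n m) (y : RR n m) :
    (∀ i, inner ℝ (ζ i) y = 0) ↔
      (fstBlock ζ)ᵀ *ᵥ fstPart y + (sndBlock ζ)ᵀ *ᵥ sndPart y = 0 := by
  rw [funext_iff]
  refine forall_congr' fun i => ?_
  rw [inner_RR_eq]
  rfl

lemma forall₂_inner_eq_zero_iff_blocks (ζ η : Fin m → RR n m) :
    (∀ i j, inner ℝ (ζ i) (η j) = 0) ↔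
      (fstBlock ζ)ᵀ * fstBlock η + (sndBlock ζ)ᵀ * sndBlock η = 0 := by
  rw [← Matrix.ext_iff]
  refine forall₂_congr fun i j => ?_
  rw [inner_RR_eq]
  rfl

lemma fstPart_fderiv {g : R n → RR n m} (hg : DifferentiableAt ℝ g x) (v : R n) :
    fstPart (fderiv ℝ g x v) = dVec (fun y => fstPart (g y)) x v :=
  funext fun k => fderiv_ofLp_apply hg v (Sum.inl k)

lemma sndPart_fderiv {g : R n → RR n m} (hg : DifferentiableAt ℝ g x) (v : R n) :
    sndPart (fderiv ℝ g x v) = dVec (fun y => sndPart (g y)) x v :=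
  funext fun k => fderiv_ofLp_apply hg v (Sum.inr k)

lemma fstBlock_fderiv {ζ : Fin m → R n → RR n m} (hζ : ∀ i, DifferentiableAt ℝ (ζ i) x)
    (v : R n) :
    fstBlock (fun i => fderiv ℝ (ζ i) x v) = dMatrix (fun y => fstBlock fun i => ζ i y) x v := by
  ext k i
  exact fderiv_ofLp_apply (hζ i) v (Sum.inl k)

lemma sndBlock_fderiv {ζ : Fin m → R n → RR n m} (hζ : ∀ i, DifferentiableAt ℝ (ζ i) x)
    (v : R n) :
    sndBlock (fun i => fderiv ℝ (ζ i) x v) = dMatrix (fun y => sndBlock fun i => ζ i y) x v := by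
  ext k i
  exact fderiv_ofLp_apply (hζ i) v (Sum.inr k)

end Blocks

/-! ### The parallel frame along the map of the construction -/

section DirectAlgebra

variable {ν μ : Type*} [Fintype ν] [Fintype μ] [DecidableEq μ] {G dG : Matrix ν μ ℝ}
  {Ω K dK : Matrix μ μ ℝ}

/-- With `K = Ω⁻¹`, the blocks `a = 𝒢 K` and `b = 1 - K` are those of an orthonormal frame. -/
lemma blocks_gram_of_adapted (hK : Ω * K = 1) (hs : Ω + Ωᵀ = Gᵀ * G + 1) :
    (G * K)ᵀ * (G * K) + (1 - K)ᵀ * (1 - K) = 1 := by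
  have hK' : Kᵀ * Ωᵀ = 1 := by rw [← Matrix.transpose_mul, hK, Matrix.transpose_one]
  have hG : Gᵀ * G = Ω + Ωᵀ - 1 := by rw [hs, add_sub_cancel_right]
  have h1 : (G * K)ᵀ * (G * K) = Kᵀ * (Gᵀ * G) * K := by
    simp only [Matrix.transpose_mul, Matrix.mul_assoc]
  rw [h1, hG, Matrix.transpose_sub, Matrix.transpose_one]
  calc Kᵀ * (Ω + Ωᵀ - 1) * K + (1 - Kᵀ) * (1 - K)
      = Kᵀ * (Ω * K) + (Kᵀ * Ωᵀ) * K + 1 - K - Kᵀ := by noncomm_ring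
    _ = 1 := by rw [hK, hK', mul_one, one_mul]; abel

/-- With `K = Ω⁻¹`, `a = 𝒢 K` and `b = 1 - K`, the relation `aᵗ da + bᵗ db = 0` holds if
`dΩ = 𝒢ᵗ d𝒢`; the hypothesis `hd` is the derivative of `Ω K = 1`. -/
lemma blocks_parallel_of_adapted (hK : Ω * K = 1) (hs : Ω + Ωᵀ = Gᵀ * G + 1)
    (hd : Gᵀ * dG * K + Ω * dK = 0) :
    (G * K)ᵀ * (dG * K + G * dK) + (1 - K)ᵀ * (0 - dK) = 0 := by
  have hK' : Kᵀ * Ωᵀ = 1 := by rw [← Matrix.transpose_mul, hK, Matrix.transpose_one]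
  have hG : Gᵀ * G = Ω + Ωᵀ - 1 := by rw [hs, add_sub_cancel_right]
  have h1 : (G * K)ᵀ * (dG * K + G * dK) = Kᵀ * (Gᵀ * dG * K) + Kᵀ * (Gᵀ * G) * dK := by
    simp only [Matrix.transpose_mul, Matrix.mul_assoc, Matrix.mul_add]
  rw [h1, hG, Matrix.transpose_sub, Matrix.transpose_one]
  calc Kᵀ * (Gᵀ * dG * K) + Kᵀ * (Ω + Ωᵀ - 1) * dK + (1 - Kᵀ) * (0 - dK)
      = Kᵀ * (Gᵀ * dG * K + Ω * dK) + (Kᵀ * Ωᵀ) * dK - dK := by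
        generalize Gᵀ * dG * K = W
        noncomm_ring
    _ = 0 := by rw [hd, hK', mul_zero, one_mul, zero_add, sub_self]

/-- The columns of the frame with blocks `𝒢 K` and `1 - K`, where `K = Ω⁻¹`, are orthogonal to the
derivative of `(x - 𝒢 c, c)`; the hypothesis `hd` is the derivative of `Ω c = φ`. -/
lemma blocks_normal_of_adapted {v : ν → ℝ} {c dc : μ → ℝ} (hK : Ω * K = 1)
    (hs : Ω + Ωᵀ = Gᵀ * G + 1) (hd : (Gᵀ * dG) *ᵥ c + Ω *ᵥ dc = Gᵀ *ᵥ v) :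
    (G * K)ᵀ *ᵥ (v - (dG *ᵥ c + G *ᵥ dc)) + (1 - K)ᵀ *ᵥ dc = 0 := by
  have hK' : Kᵀ * Ωᵀ = 1 := by rw [← Matrix.transpose_mul, hK, Matrix.transpose_one]
  have hG : Gᵀ * G = Ω + Ωᵀ - 1 := by rw [hs, add_sub_cancel_right]
  have h1 : Gᵀ *ᵥ (v - (dG *ᵥ c + G *ᵥ dc)) = (1 - Ωᵀ) *ᵥ dc := by
    rw [Matrix.mulVec_sub, Matrix.mulVec_add, ← hd, Matrix.mulVec_mulVec, Matrix.mulVec_mulVec, hG]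
    simp only [Matrix.sub_mulVec, Matrix.add_mulVec]
    abel
  rw [Matrix.transpose_mul, ← Matrix.mulVec_mulVec, h1, Matrix.mulVec_mulVec, Matrix.mul_sub, hK',
    mul_one, ← Matrix.add_mulVec, Matrix.transpose_sub, Matrix.transpose_one]
  simp

end DirectAlgebra

section Direct

variable {n m : ℕ} {φ : Fin m → R n → ℝ} {Ω : R n → Matrix (Fin m) (Fin m) ℝ} {V : Set (R n)}

/-- The normal fields `(𝒢 Ω⁻¹ η, η - Ω⁻¹ η)` along `ribaucourMap φ Ω`, for `η` in the standard
basis of `ℝ^m`. -/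
def adaptedFrame (φ : Fin m → R n → ℝ) (Ω : R n → Matrix (Fin m) (Fin m) ℝ) (i : Fin m)
    (x : R n) : RR n m :=
  WithLp.toLp 2 (Sum.elim (fun k => (gradMatrix φ x * (Ω x)⁻¹) k i)
    (fun j => (1 - (Ω x)⁻¹) j i))

lemma contDiffOn_RR {g : R n → RR n m} (h₁ : ∀ k, ContDiffOn ℝ ∞ (fun x => fstPart (g x) k) V)
    (h₂ : ∀ j, ContDiffOn ℝ ∞ (fun x => sndPart (g x) j) V) : ContDiffOn ℝ ∞ g V := by
  rw [contDiffOn_euclidean]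
  rintro (k | j)
  · exact h₁ k
  · exact h₂ j

lemma contDiffOn_fstPart {g : R n → RR n m} (hg : ContDiffOn ℝ ∞ g V) (k : Fin n) :
    ContDiffOn ℝ ∞ (fun x => fstPart (g x) k) V :=
  contDiffOn_euclidean.1 hg (Sum.inl k)

lemma contDiffOn_sndPart {g : R n → RR n m} (hg : ContDiffOn ℝ ∞ g V) (j : Fin m) :
    ContDiffOn ℝ ∞ (fun x => sndPart (g x) j) V :=
  contDiffOn_euclidean.1 hg (Sum.inr j)

lemma differentiableAt_of_contDiffOn {E F : Type*} [NormedAddCommGroup E] [NormedSpace ℝ E]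
    [NormedAddCommGroup F] [NormedSpace ℝ F] {g : E → F} {V : Set E} {x : E} (hV : IsOpen V)
    (hg : ContDiffOn ℝ ∞ g V) (hx : x ∈ V) : DifferentiableAt ℝ g x :=
  (hg.contDiffAt (hV.mem_nhds hx)).differentiableAt (by simp)

lemma IsAdapted.contDiffOn_coeff (hΩ : IsAdapted φ Ω V) (hφ : ∀ i, ContDiffOn ℝ ∞ (φ i) V)
    (i : Fin m) : ContDiffOn ℝ ∞ (fun x => coeff φ Ω x i) V :=
  contDiffOn_matrix_mulVec (contDiffOn_matrix_inv hΩ.smooth hΩ.invertible) hφ i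

lemma IsAdapted.contDiffOn_ribaucourMap (hΩ : IsAdapted φ Ω V) (hV : IsOpen V)
    (hφ : ∀ i, ContDiffOn ℝ ∞ (φ i) V) : ContDiffOn ℝ ∞ (ribaucourMap φ Ω) V := by
  refine contDiffOn_RR (fun k => ?_) (hΩ.contDiffOn_coeff hφ)
  exact ((EuclideanSpace.proj (𝕜 := ℝ) k).contDiff.contDiffOn).sub
    (contDiffOn_matrix_mulVec (contDiffOn_gradMatrix hV hφ) (hΩ.contDiffOn_coeff hφ) k)

/-- The fields `adaptedFrame φ Ω` form a parallel orthonormal normal frame on all of `V`, critical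
points included. -/
theorem IsAdapted.isParallelNormalFrame (hΩ : IsAdapted φ Ω V) (hV : IsOpen V)
    (hφ : ∀ i, ContDiffOn ℝ ∞ (φ i) V) :
    IsParallelNormalFrame (ribaucourMap φ Ω) (adaptedFrame φ Ω) V := by
  have hKs := contDiffOn_matrix_inv hΩ.smooth hΩ.invertible
  have hGs := contDiffOn_gradMatrix hV hφ
  have hcs := hΩ.contDiffOn_coeff hφ
  have hζs : ∀ i, ContDiffOn ℝ ∞ (adaptedFrame φ Ω i) V := fun i =>
    contDiffOn_RR (fun k => contDiffOn_matrix_mul hGs hKs k i)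
      (fun j => contDiffOn_const.sub (hKs j i))
  have hinv : ∀ x ∈ V, Ω x * (Ω x)⁻¹ = 1 := fun x hx =>
    Matrix.mul_nonsing_inv _ ((Matrix.isUnit_iff_isUnit_det _).1 (hΩ.invertible x hx))
  refine ⟨hζs, fun x hx => ?_, fun x hx a v => ?_, fun x hx a b v => ?_⟩
  · rw [orthonormal_iff_blocks]
    exact blocks_gram_of_adapted (hinv x hx) (hΩ.add_transpose x hx)
  · refine (forall_inner_eq_zero_iff_blocks (fun a => adaptedFrame φ Ω a x) _).2 ?_ a
    have hG : ∀ k i, DifferentiableAt ℝ (fun y => gradMatrix φ y k i) x := fun k i =>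
      differentiableAt_of_contDiffOn hV (hGs k i) hx
    have hc : ∀ i, DifferentiableAt ℝ (fun y => coeff φ Ω y i) x := fun i =>
      differentiableAt_of_contDiffOn hV (hcs i) hx
    have hg := differentiableAt_of_contDiffOn hV (hΩ.contDiffOn_ribaucourMap hV hφ) hx
    rw [fstPart_fderiv hg, sndPart_fderiv hg]
    have e1 : dVec (fun y => fstPart (ribaucourMap φ Ω y)) x v =
        v.ofLp - (dMatrix (gradMatrix φ) x v *ᵥ coeff φ Ω x +
          gradMatrix φ x *ᵥ dVec (coeff φ Ω) x v) := by
      change dVec (fun y => y.ofLp - gradMatrix φ y *ᵥ coeff φ Ω y) x v = _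
      rw [dVec_sub, dVec_ofLp, dVec_mulVec hG hc]
      · exact fun k => (EuclideanSpace.proj (𝕜 := ℝ) k).differentiableAt
      · exact fun k => differentiableAt_of_contDiffOn hV (contDiffOn_matrix_mulVec hGs hcs k) hx
    -- differentiate `Ω c = φ`
    have e2 : ((gradMatrix φ x)ᵀ * dMatrix (gradMatrix φ) x v) *ᵥ coeff φ Ω x +
        Ω x *ᵥ dVec (coeff φ Ω) x v = (gradMatrix φ x)ᵀ *ᵥ v.ofLp := by
      rw [← hΩ.deriv_eq x hx, ← dVec_eq_gradMatrix_transpose_mulVec, ← dVec_mulVec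
        (fun i j => differentiableAt_of_contDiffOn hV (hΩ.smooth i j) hx) hc]
      refine dVec_congr ?_ v
      filter_upwards [hV.mem_nhds hx] with y hy
      rw [coeff, Matrix.mulVec_mulVec, hinv y hy, Matrix.one_mulVec]
    rw [e1]
    exact blocks_normal_of_adapted (hinv x hx) (hΩ.add_transpose x hx) e2
  · refine (forall₂_inner_eq_zero_iff_blocks (fun a => adaptedFrame φ Ω a x)
      (fun b => fderiv ℝ (adaptedFrame φ Ω b) x v)).2 ?_ a b
    have hG : ∀ k i, DifferentiableAt ℝ (fun y => gradMatrix φ y k i) x := fun k i =>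
      differentiableAt_of_contDiffOn hV (hGs k i) hx
    have hK : ∀ k i, DifferentiableAt ℝ (fun y => (Ω y)⁻¹ k i) x := fun k i =>
      differentiableAt_of_contDiffOn hV (hKs k i) hx
    have hζ := fun i => differentiableAt_of_contDiffOn hV (hζs i) hx
    rw [fstBlock_fderiv hζ, sndBlock_fderiv hζ]
    have e1 : dMatrix (fun y => fstBlock fun i => adaptedFrame φ Ω i y) x v =
        dMatrix (gradMatrix φ) x v * (Ω x)⁻¹ +
          gradMatrix φ x * dMatrix (fun y => (Ω y)⁻¹) x v := dMatrix_mul hG hK v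
    have e2 : dMatrix (fun y => sndBlock fun i => adaptedFrame φ Ω i y) x v =
        0 - dMatrix (fun y => (Ω y)⁻¹) x v := by
      change dMatrix (fun y => 1 - (Ω y)⁻¹) x v = _
      rw [dMatrix_sub (A := fun _ => 1) (fun i j => differentiableAt_const _) hK, dMatrix_const]
    -- differentiate `Ω Ω⁻¹ = 1`
    have e3 : (gradMatrix φ x)ᵀ * dMatrix (gradMatrix φ) x v * (Ω x)⁻¹ +
        Ω x * dMatrix (fun y => (Ω y)⁻¹) x v = 0 := by
      rw [← hΩ.deriv_eq x hx, ← dMatrix_mul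
        (fun i j => differentiableAt_of_contDiffOn hV (hΩ.smooth i j) hx) hK,
        ← dMatrix_const 1 x v]
      refine dMatrix_congr ?_ v
      filter_upwards [hV.mem_nhds hx] with y hy
      exact hinv y hy
    rw [e1, e2]
    exact blocks_parallel_of_adapted (hinv x hx) (hΩ.add_transpose x hx) e3

theorem IsAdapted.isOpen_regularPoints (hΩ : IsAdapted φ Ω V) (hV : IsOpen V)
    (hφ : ∀ i, ContDiffOn ℝ ∞ (φ i) V) : IsOpen (regularPoints (ribaucourMap φ Ω) V) := by
  have hd : ContinuousOn (fderiv ℝ (ribaucourMap φ Ω)) V :=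
    ((hΩ.contDiffOn_ribaucourMap hV hφ).fderiv_of_isOpen (m := ∞) hV le_rfl).continuousOn
  exact hd.isOpen_inter_preimage hV ContinuousLinearMap.isOpen_injective

theorem IsAdapted.flatNormalBundleOn (hΩ : IsAdapted φ Ω V) (hV : IsOpen V)
    (hφ : ∀ i, ContDiffOn ℝ ∞ (φ i) V) :
    FlatNormalBundleOn (ribaucourMap φ Ω) (regularPoints (ribaucourMap φ Ω) V) :=
  (hΩ.isParallelNormalFrame hV hφ).flatNormalBundleOn (by simp) (fun _ hx => hx.2)
    fun _ hx => hx.1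

end Direct

/-! ### From a parallel frame to `φ` and `Ω` -/

section ConverseAlgebra

variable {ν μ : Type*} [Fintype ν] [Fintype μ] [DecidableEq μ] {a da dG : Matrix ν μ ℝ}
  {b db Ω dΩ : Matrix μ μ ℝ}

/-- Orthonormality of the frame with blocks `a` and `b`, read on `Ω = (1 - b)⁻¹` and
`𝒢 = a Ω`. -/
lemma add_transpose_eq_of_blocks (hΩ : b * Ω = Ω - 1) (hgram : aᵀ * a + bᵀ * b = 1) :
    Ω + Ωᵀ = (a * Ω)ᵀ * (a * Ω) + 1 := by
  have h1 : (a * Ω)ᵀ * (a * Ω) = Ωᵀ * (aᵀ * a) * Ω := by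
    simp only [Matrix.transpose_mul, Matrix.mul_assoc]
  have h2 : Ωᵀ * bᵀ = Ωᵀ - 1 := by
    rw [← Matrix.transpose_mul, hΩ, Matrix.transpose_sub, Matrix.transpose_one]
  rw [h1, eq_sub_of_add_eq hgram]
  calc Ω + Ωᵀ = Ωᵀ * Ω - (Ωᵀ - 1) * (Ω - 1) + 1 := by noncomm_ring
    _ = Ωᵀ * (1 - bᵀ * b) * Ω + 1 := by rw [← h2, ← hΩ]; noncomm_ring

/-- Parallelism of the frame with blocks `a` and `b`, read on `Ω = (1 - b)⁻¹` and `𝒢 = a Ω`; the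
hypothesis `hd` is the derivative of `b Ω = Ω - 1`. -/
lemma deriv_eq_of_blocks (hΩ : b * Ω = Ω - 1) (hgram : aᵀ * a + bᵀ * b = 1)
    (hpar : aᵀ * da + bᵀ * db = 0) (hd : db * Ω + b * dΩ = dΩ) :
    dΩ = (a * Ω)ᵀ * (da * Ω + a * dΩ) := by
  have h1 : (a * Ω)ᵀ * (da * Ω + a * dΩ) = Ωᵀ * (aᵀ * da) * Ω + Ωᵀ * (aᵀ * a) * dΩ := by
    simp only [Matrix.transpose_mul, Matrix.mul_assoc, Matrix.mul_add]
  have h2 : Ωᵀ * bᵀ = Ωᵀ - 1 := by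
    rw [← Matrix.transpose_mul, hΩ, Matrix.transpose_sub, Matrix.transpose_one]
  rw [h1, eq_sub_of_add_eq hgram, eq_neg_of_add_eq_zero_left hpar]
  calc dΩ = Ωᵀ * dΩ - (Ωᵀ - 1) * dΩ := by noncomm_ring
    _ = Ωᵀ * dΩ - Ωᵀ * bᵀ * (db * Ω + b * dΩ) := by rw [hd, h2]
    _ = Ωᵀ * -(bᵀ * db) * Ω + Ωᵀ * (1 - bᵀ * b) * dΩ := by noncomm_ring

/-- Normality of the frame along `(f₁, f₂)`, read on `𝒢 = a Ω`: here `u = df₁`, `w = df₂`,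
`c = f₂`, `v` is the derivative of `f₁ + 𝒢 f₂`, and the conclusion is `d(Ω f₂) = 𝒢ᵗ v`. -/
lemma mulVec_eq_of_blocks {u v : ν → ℝ} {c w : μ → ℝ} (hΩ : b * Ω = Ω - 1)
    (hsym : Ω + Ωᵀ = (a * Ω)ᵀ * (a * Ω) + 1) (hd : dΩ = (a * Ω)ᵀ * dG)
    (hn : aᵀ *ᵥ u + bᵀ *ᵥ w = 0) (hv : u + (dG *ᵥ c + (a * Ω) *ᵥ w) = v) :
    dΩ *ᵥ c + Ω *ᵥ w = (a * Ω)ᵀ *ᵥ v := by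
  have h2 : Ωᵀ * bᵀ = Ωᵀ - 1 := by
    rw [← Matrix.transpose_mul, hΩ, Matrix.transpose_sub, Matrix.transpose_one]
  have h3 : (a * Ω)ᵀ *ᵥ u = (1 - Ωᵀ) *ᵥ w := by
    rw [Matrix.transpose_mul, ← Matrix.mulVec_mulVec, eq_neg_of_add_eq_zero_left hn,
      Matrix.mulVec_neg, Matrix.mulVec_mulVec, h2, ← Matrix.neg_mulVec, neg_sub]
  rw [← hv, Matrix.mulVec_add, Matrix.mulVec_add, h3, Matrix.mulVec_mulVec, Matrix.mulVec_mulVec,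
    ← hd, eq_sub_of_add_eq hsym.symm]
  simp only [Matrix.sub_mulVec, Matrix.add_mulVec]
  abel

/-- A square matrix can be made free of the eigenvalue `1` by changing signs of its columns: the
two values of `det (1 - b)` for the two signs of one column add up to twice the determinant
without this column. -/
lemma exists_signs_isUnit_one_sub (b : Matrix μ μ ℝ) :
    ∃ ε : μ → ℝ, (∀ i, ε i * ε i = 1) ∧ IsUnit (1 - Matrix.of fun j i => ε i * b j i) := by
  have key : ∀ s : Finset μ, ∃ ε : μ → ℝ, (∀ i, ε i * ε i = 1) ∧
      (Matrix.of fun j i => (1 : Matrix μ μ ℝ) j i - if i ∈ s then ε i * b j i else 0).det ≠ 0 := by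
    intro s
    induction s using Finset.induction_on with
    | empty =>
      refine ⟨fun _ => 1, by simp, ?_⟩
      have : (Matrix.of fun j i => (1 : Matrix μ μ ℝ) j i -
          if i ∈ (∅ : Finset μ) then (1 : ℝ) * b j i else 0) = 1 := by
        ext j i
        simp
      rw [this]
      simp
    | insert i s his ih =>
      obtain ⟨ε, hε, hdet⟩ := ih
      set A := Matrix.of fun j i => (1 : Matrix μ μ ℝ) j i - if i ∈ s then ε i * b j i else 0
        with hA
      have hcol : ∀ e : ℝ, (Matrix.of fun j k => (1 : Matrix μ μ ℝ) j k -
          if k ∈ insert i s then Function.update ε i e k * b j k else 0) =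
          A.updateCol i (fun j => (1 : Matrix μ μ ℝ) j i + -e * b j i) := by
        intro e
        ext j k
        by_cases hk : k = i
        · subst hk
          simp [sub_eq_add_neg]
        · simp [hk, hA]
      have hAi : A.updateCol i (fun j => (1 : Matrix μ μ ℝ) j i) = A := by
        ext j k
        by_cases hk : k = i
        · subst hk
          simp [hA, his]
        · simp [hk]
      have hlin : ∀ e : ℝ, (A.updateCol i (fun j => (1 : Matrix μ μ ℝ) j i + -e * b j i)).det =
          A.det + -e * (A.updateCol i fun j => b j i).det := by
        intro e
        have := Matrix.det_updateCol_add A i (fun j => (1 : Matrix μ μ ℝ) j i)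
          (-e • fun j => b j i)
        rw [Matrix.det_updateCol_smul, hAi] at this
        exact this
      have hsq : ∀ e : ℝ, e * e = 1 → ∀ k, Function.update ε i e k * Function.update ε i e k = 1 := by
        intro e he k
        by_cases hk : k = i
        · subst hk
          simpa using he
        · simpa [hk] using hε k
      by_cases h1 : A.det + -1 * (A.updateCol i fun j => b j i).det = 0
      · refine ⟨Function.update ε i (-1), hsq _ (by norm_num), ?_⟩
        rw [hcol, hlin]
        intro h2
        exact hdet (by linarith)
      · refine ⟨Function.update ε i 1, hsq _ (by norm_num), ?_⟩
        rw [hcol, hlin]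
        exact h1
  obtain ⟨ε, hε, hdet⟩ := key Finset.univ
  refine ⟨ε, hε, (Matrix.isUnit_iff_isUnit_det _).2 (isUnit_iff_ne_zero.2 ?_)⟩
  convert hdet using 2
  ext j i
  simp

end ConverseAlgebra

section Converse

variable {n m : ℕ} {φ : Fin m → R n → ℝ} {Ω : R n → Matrix (Fin m) (Fin m) ℝ} {V : Set (R n)}

/-- Symmetry of the second derivatives of `Ω` gives the commutation of the Hessians. -/
lemma IsAdapted.commutingHessiansOn (hΩ : IsAdapted φ Ω V) (hV : IsOpen V)
    (hφ : ∀ i, ContDiffOn ℝ ∞ (φ i) V) : CommutingHessiansOn φ V := by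
  refine ⟨hφ, fun x hx i j => (fderiv_hessForm_symm_iff hV (hφ i) (hφ j) hx).1 fun u v => ?_⟩
  have hev : hessForm (φ i) (φ j) =ᶠ[𝓝 x] fderiv ℝ fun y => Ω y i j := by
    filter_upwards [hV.mem_nhds hx] with y hy
    ext v
    rw [← gradMatrix_transpose_mul_dMatrix_apply hV hφ hy, ← hΩ.deriv_eq y hy]
    rfl
  rw [hev.fderiv_eq]
  exact ((hΩ.smooth i j).contDiffAt (hV.mem_nhds hx)).isSymmSndFDerivAt
    (by simp; exact ENat.LEInfty.out) u v

/-- `Ω = (1 - b)⁻¹`, where `b` is the `ℝ^m`-block of the normal frame. -/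
def frameOmega (ζ : Fin m → R n → RR n m) (x : R n) : Matrix (Fin m) (Fin m) ℝ :=
  (1 - sndBlock fun i => ζ i x)⁻¹

/-- `𝒢 = a Ω`, where `a` is the `ℝ^n`-block of the normal frame. -/
def frameG (ζ : Fin m → R n → RR n m) (x : R n) : Matrix (Fin n) (Fin m) ℝ :=
  (fstBlock fun i => ζ i x) * frameOmega ζ x

/-- The map `g₁ + 𝒢 g₂`, whose components are the coordinates in which `𝒢` becomes a matrix of
gradients. -/
def frameCoord (g : R n → RR n m) (ζ : Fin m → R n → RR n m) (x : R n) : R n :=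
  WithLp.toLp 2 (fstPart (g x) + frameG ζ x *ᵥ sndPart (g x))

variable {g : R n → RR n m} {ζ : Fin m → R n → RR n m}

lemma sndBlock_mul_frameOmega {x : R n} (hu : IsUnit (1 - sndBlock fun i => ζ i x)) :
    (sndBlock fun i => ζ i x) * frameOmega ζ x = frameOmega ζ x - 1 := by
  have := Matrix.mul_nonsing_inv _ ((Matrix.isUnit_iff_isUnit_det _).1 hu)
  rw [sub_mul, one_mul] at this
  rw [← this, frameOmega, sub_sub_cancel]

lemma IsParallelNormalFrame.contDiffOn_frameOmega (hζ : IsParallelNormalFrame g ζ V)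
    (hu : ∀ x ∈ V, IsUnit (1 - sndBlock fun i => ζ i x)) (i j : Fin m) :
    ContDiffOn ℝ ∞ (fun x => frameOmega ζ x i j) V :=
  contDiffOn_matrix_inv (A := fun x => 1 - sndBlock fun i => ζ i x)
    (fun i j => contDiffOn_const.sub (contDiffOn_sndPart (hζ.smooth j) i)) hu i j

lemma IsParallelNormalFrame.contDiffOn_frameG (hζ : IsParallelNormalFrame g ζ V)
    (hu : ∀ x ∈ V, IsUnit (1 - sndBlock fun i => ζ i x)) (k : Fin n) (j : Fin m) :
    ContDiffOn ℝ ∞ (fun x => frameG ζ x k j) V :=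
  contDiffOn_matrix_mul (A := fun x => fstBlock fun i => ζ i x)
    (fun k i => contDiffOn_fstPart (hζ.smooth i) k) (hζ.contDiffOn_frameOmega hu) k j

lemma IsParallelNormalFrame.frameOmega_add_transpose (hζ : IsParallelNormalFrame g ζ V)
    (hu : ∀ x ∈ V, IsUnit (1 - sndBlock fun i => ζ i x)) {x : R n} (hx : x ∈ V) :
    frameOmega ζ x + (frameOmega ζ x)ᵀ = (frameG ζ x)ᵀ * frameG ζ x + 1 :=
  add_transpose_eq_of_blocks (sndBlock_mul_frameOmega (hu x hx))
    ((orthonormal_iff_blocks _).1 (hζ.orthonormal x hx))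

lemma IsParallelNormalFrame.dMatrix_frameOmega (hV : IsOpen V) (hζ : IsParallelNormalFrame g ζ V)
    (hu : ∀ x ∈ V, IsUnit (1 - sndBlock fun i => ζ i x)) {x : R n} (hx : x ∈ V) (v : R n) :
    dMatrix (frameOmega ζ) x v = (frameG ζ x)ᵀ * dMatrix (frameG ζ) x v := by
  have hζd := fun i => differentiableAt_of_contDiffOn hV (hζ.smooth i) hx
  have hΩd := fun i j => differentiableAt_of_contDiffOn hV (hζ.contDiffOn_frameOmega hu i j) hx
  have had : ∀ k i, DifferentiableAt ℝ (fun y => (fstBlock fun i => ζ i y) k i) x := fun k i =>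
    differentiableAt_of_contDiffOn hV (contDiffOn_fstPart (hζ.smooth i) k) hx
  have hbd : ∀ k i, DifferentiableAt ℝ (fun y => (sndBlock fun i => ζ i y) k i) x := fun k i =>
    differentiableAt_of_contDiffOn hV (contDiffOn_sndPart (hζ.smooth i) k) hx
  have e1 : dMatrix (frameG ζ) x v =
      dMatrix (fun y => fstBlock fun i => ζ i y) x v * frameOmega ζ x +
        (fstBlock fun i => ζ i x) * dMatrix (frameOmega ζ) x v := dMatrix_mul had hΩd v
  have e2 : dMatrix (fun y => sndBlock fun i => ζ i y) x v * frameOmega ζ x +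
      (sndBlock fun i => ζ i x) * dMatrix (frameOmega ζ) x v = dMatrix (frameOmega ζ) x v := by
    rw [← dMatrix_mul hbd hΩd]
    have hev : (fun y => (sndBlock fun i => ζ i y) * frameOmega ζ y) =ᶠ[𝓝 x]
        fun y => frameOmega ζ y - 1 := by
      filter_upwards [hV.mem_nhds hx] with y hy
      exact sndBlock_mul_frameOmega (hu y hy)
    rw [dMatrix_congr hev, dMatrix_sub (B := fun _ => 1) hΩd (fun i j => differentiableAt_const _),
      dMatrix_const, sub_zero]
  have e3 := (forall₂_inner_eq_zero_iff_blocks (fun i => ζ i x)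
    (fun i => fderiv ℝ (ζ i) x v)).1 fun a b => hζ.parallel x hx a b v
  rw [fstBlock_fderiv hζd, sndBlock_fderiv hζd] at e3
  rw [e1]
  exact deriv_eq_of_blocks (sndBlock_mul_frameOmega (hu x hx))
    ((orthonormal_iff_blocks _).1 (hζ.orthonormal x hx)) e3 e2

lemma contDiffOn_frameCoord (hg : ContDiffOn ℝ ∞ g V) (hζ : IsParallelNormalFrame g ζ V)
    (hu : ∀ x ∈ V, IsUnit (1 - sndBlock fun i => ζ i x)) : ContDiffOn ℝ ∞ (frameCoord g ζ) V := by
  rw [contDiffOn_euclidean]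
  exact fun k => (contDiffOn_fstPart hg k).add
    (contDiffOn_matrix_mulVec (hζ.contDiffOn_frameG hu) (contDiffOn_sndPart hg) k)

/-- The product rule for `frameCoord`, with the derivative of `g` taken as a vector. -/
lemma fderiv_frameCoord (hV : IsOpen V) (hg : ContDiffOn ℝ ∞ g V)
    (hζ : IsParallelNormalFrame g ζ V) (hu : ∀ x ∈ V, IsUnit (1 - sndBlock fun i => ζ i x))
    {x : R n} (hx : x ∈ V) (v : R n) :
    fstPart (fderiv ℝ g x v) + (dMatrix (frameG ζ) x v *ᵥ sndPart (g x) +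
      frameG ζ x *ᵥ sndPart (fderiv ℝ g x v)) = (fderiv ℝ (frameCoord g ζ) x v).ofLp := by
  have hgd := differentiableAt_of_contDiffOn hV hg hx
  have hGd := fun k i => differentiableAt_of_contDiffOn hV (hζ.contDiffOn_frameG hu k i) hx
  have h1d := fun k => differentiableAt_of_contDiffOn hV (contDiffOn_fstPart hg k) hx
  have h2d := fun k => differentiableAt_of_contDiffOn hV (contDiffOn_sndPart hg k) hx
  rw [fstPart_fderiv hgd, sndPart_fderiv hgd, ← dVec_mulVec hGd h2d, ← dVec_add h1d]
  · ext k
    exact (fderiv_ofLp_apply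
      (differentiableAt_of_contDiffOn hV (contDiffOn_frameCoord hg hζ hu) hx) v k).symm
  · exact fun k => differentiableAt_of_contDiffOn hV
      (contDiffOn_matrix_mulVec (hζ.contDiffOn_frameG hu) (contDiffOn_sndPart hg) k) hx

/-- Where `g₂` vanishes, `g₁ + 𝒢 g₂` is an immersion if `g` is. -/
lemma injective_fderiv_frameCoord (hV : IsOpen V) (hg : ContDiffOn ℝ ∞ g V)
    (hζ : IsParallelNormalFrame g ζ V) (hu : ∀ x ∈ V, IsUnit (1 - sndBlock fun i => ζ i x))
    {x : R n} (hx : x ∈ V) (h0 : sndPart (g x) = 0)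
    (hinj : Function.Injective (fderiv ℝ g x)) :
    Function.Injective (fderiv ℝ (frameCoord g ζ) x) := by
  rw [injective_iff_map_eq_zero]
  intro v hv
  have e := fderiv_frameCoord hV hg hζ hu hx v
  rw [hv, h0, Matrix.mulVec_zero, zero_add] at e
  have hn := (forall_inner_eq_zero_iff_blocks (fun i => ζ i x) (fderiv ℝ g x v)).1
    fun i => hζ.normal x hx i v
  have h1 := mulVec_eq_of_blocks (v := 0) (c := 0) (dG := 0) (dΩ := 0)
    (sndBlock_mul_frameOmega (hu x hx)) (hζ.frameOmega_add_transpose hu hx) (by simp) hn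
    (by rw [Matrix.zero_mulVec, zero_add]; exact e)
  have hsnd : sndPart (fderiv ℝ g x v) = 0 := by
    have hinjΩ := Matrix.mulVec_injective_iff_isUnit.2
      (isUnit_of_add_transpose_eq (hζ.frameOmega_add_transpose hu hx))
    apply hinjΩ
    simpa using h1
  have hfst : fstPart (fderiv ℝ g x v) = 0 := by
    rw [hsnd, Matrix.mulVec_zero, add_zero] at e
    simpa using e
  exact (injective_iff_map_eq_zero _).1 hinj v (RR_ext hfst hsnd)

/-- If `g₁ + 𝒢 g₂` is the identity, then `g` is the map of the construction, for `φ = Ω g₂`. -/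
theorem exists_eq_ribaucourMap_of_frameCoord_eq (hV : IsOpen V) (hg : ContDiffOn ℝ ∞ g V)
    (hζ : IsParallelNormalFrame g ζ V) (hu : ∀ x ∈ V, IsUnit (1 - sndBlock fun i => ζ i x))
    (hid : ∀ x ∈ V, frameCoord g ζ x = x) :
    ∃ (φ : Fin m → R n → ℝ) (Ω : R n → Matrix (Fin m) (Fin m) ℝ), CommutingHessiansOn φ V ∧
      IsAdapted φ Ω V ∧ ∀ x ∈ V, g x = ribaucourMap φ Ω x := by
  set φ : Fin m → R n → ℝ := fun i x => (frameOmega ζ x *ᵥ sndPart (g x)) i with hφdef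
  have hφ : ∀ i, ContDiffOn ℝ ∞ (φ i) V := fun i =>
    contDiffOn_matrix_mulVec (hζ.contDiffOn_frameOmega hu) (contDiffOn_sndPart hg) i
  have hG : ∀ x ∈ V, gradMatrix φ x = frameG ζ x := by
    intro x hx
    have hvec : ∀ v : R n, (gradMatrix φ x)ᵀ *ᵥ v.ofLp = (frameG ζ x)ᵀ *ᵥ v.ofLp := by
      intro v
      have hgd := differentiableAt_of_contDiffOn hV hg hx
      have e1 := dVec_mulVec
        (fun i j => differentiableAt_of_contDiffOn hV (hζ.contDiffOn_frameOmega hu i j) hx)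
        (fun k => differentiableAt_of_contDiffOn hV (contDiffOn_sndPart hg k) hx) v
      have e2 := fderiv_frameCoord hV hg hζ hu hx v
      have hev : frameCoord g ζ =ᶠ[𝓝 x] id := by
        filter_upwards [hV.mem_nhds hx] with y hy using hid y hy
      rw [hev.fderiv_eq, fderiv_id] at e2
      rw [← dVec_eq_gradMatrix_transpose_mulVec]
      refine e1.trans ?_
      rw [← sndPart_fderiv hgd]
      exact mulVec_eq_of_blocks (sndBlock_mul_frameOmega (hu x hx))
        (hζ.frameOmega_add_transpose hu hx) (hζ.dMatrix_frameOmega hV hu hx v)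
        ((forall_inner_eq_zero_iff_blocks (fun i => ζ i x) (fderiv ℝ g x v)).1
          fun i => hζ.normal x hx i v) e2
    exact Matrix.transpose_injective
      (Matrix.mulVec_injective (funext fun w => hvec (WithLp.toLp 2 w)))
  have hunit : ∀ x ∈ V, IsUnit (frameOmega ζ x) := fun x hx =>
    isUnit_of_add_transpose_eq (hζ.frameOmega_add_transpose hu hx)
  have hΩ : IsAdapted φ (frameOmega ζ) V := by
    refine ⟨hζ.contDiffOn_frameOmega hu, hunit, fun x hx v => ?_, fun x hx => ?_⟩
    · have hev : gradMatrix φ =ᶠ[𝓝 x] frameG ζ := by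
        filter_upwards [hV.mem_nhds hx] with y hy using hG y hy
      rw [dMatrix_congr hev, hG x hx]
      exact hζ.dMatrix_frameOmega hV hu hx v
    · rw [hG x hx]
      exact hζ.frameOmega_add_transpose hu hx
  refine ⟨φ, frameOmega ζ, hΩ.commutingHessiansOn hV hφ, hΩ, fun x hx => ?_⟩
  have hc : coeff φ (frameOmega ζ) x = sndPart (g x) := by
    change (frameOmega ζ x)⁻¹ *ᵥ (frameOmega ζ x *ᵥ sndPart (g x)) = _
    rw [Matrix.mulVec_mulVec, Matrix.nonsing_inv_mul _
      ((Matrix.isUnit_iff_isUnit_det _).1 (hunit x hx)), Matrix.one_mulVec]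
  refine RR_ext ?_ hc.symm
  change fstPart (g x) = x.ofLp - gradMatrix φ x *ᵥ coeff φ (frameOmega ζ) x
  have := congrArg WithLp.ofLp (hid x hx)
  rw [hc, hG x hx, ← this]
  exact (add_sub_cancel_right _ _).symm

end Converse

/-! ### Local form of immersions with flat normal bundle -/

section LocalForm

variable {n m : ℕ}

/-- The inverse function theorem for a smooth map without critical points, as a diffeomorphism
onto a ball. -/
lemma exists_diffeomorph_onto_ball {X : R n → R n} {W : Set (R n)} (hW : IsOpen W)
    (hX : ContDiffOn ℝ ∞ X W) (hinj : ∀ y ∈ W, Function.Injective (fderiv ℝ X y)) {y₀ : R n}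
    (hy₀ : y₀ ∈ W) :
    ∃ Ψ : OpenPartialHomeomorph (R n) (R n), (∀ y, Ψ y = X y) ∧ y₀ ∈ Ψ.source ∧ Ψ.source ⊆ W ∧
      (∃ r > 0, Ψ.target = ball (X y₀) r) ∧ ContDiffOn ℝ ∞ Ψ.symm Ψ.target := by
  have hequiv : ∀ y ∈ W, ∃ L : R n ≃L[ℝ] R n, HasFDerivAt X (L : R n →L[ℝ] R n) y := by
    intro y hy
    refine ⟨(LinearEquiv.ofInjectiveEndo (fderiv ℝ X y : R n →ₗ[ℝ] R n)
      (hinj y hy)).toContinuousLinearEquiv, ?_⟩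
    exact (differentiableAt_of_contDiffOn hW hX hy).hasFDerivAt.congr_fderiv
      (ContinuousLinearMap.ext fun _ => rfl)
  obtain ⟨L, hL⟩ := hequiv y₀ hy₀
  have hXat : ContDiffAt ℝ ∞ X y₀ := hX.contDiffAt (hW.mem_nhds hy₀)
  set Φ := hXat.toOpenPartialHomeomorph X hL (by simp) with hΦ
  have hΦX : (Φ : R n → R n) = X := rfl
  have hsrc : y₀ ∈ Φ.source := hXat.mem_toOpenPartialHomeomorph_source hL (by simp)
  have htgt : X y₀ ∈ Φ.target := hXat.image_mem_toOpenPartialHomeomorph_target hL (by simp)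
  have hopen := Φ.isOpen_inter_preimage_symm hW
  have hleft : Φ.symm (X y₀) = y₀ := Φ.left_inv hsrc
  obtain ⟨r, hr, hball⟩ := Metric.isOpen_iff.1 hopen (X y₀)
    ⟨htgt, by rw [mem_preimage, hleft]; exact hy₀⟩
  set Ψ := (Φ.symm.restrOpen (ball (X y₀) r) isOpen_ball).symm with hΨ
  have hΨt : Ψ.target = ball (X y₀) r := by
    change Φ.target ∩ ball (X y₀) r = _
    exact inter_eq_right.2 fun z hz => (hball hz).1
  have hΨW : Ψ.source ⊆ W := by
    intro y hy
    have hz := Ψ.map_source hy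
    rw [← Ψ.left_inv hy]
    rw [hΨt] at hz
    exact (hball hz).2
  refine ⟨Ψ, fun y => rfl, ?_, hΨW, ⟨r, hr, hΨt⟩, fun z hz => ?_⟩
  · have : X y₀ ∈ Ψ.target := by
      rw [hΨt]
      exact mem_ball_self hr
    rw [← hleft]
    exact Ψ.map_target this
  · have hzW : Ψ.symm z ∈ W := hΨW (Ψ.map_target hz)
    obtain ⟨L', hL'⟩ := hequiv _ hzW
    exact (Ψ.contDiffAt_symm hz hL' (hX.contDiffAt (hW.mem_nhds hzW))).contDiffWithinAt

/-- A change of coordinates takes parallel normal frames to parallel normal frames. -/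
lemma IsParallelNormalFrame.comp {g : R n → RR n m} {ζ : Fin m → R n → RR n m} {V W : Set (R n)}
    {σ : R n → R n} (hV : IsOpen V) (hW : IsOpen W) (hg : ContDiffOn ℝ ∞ g V)
    (hζ : IsParallelNormalFrame g ζ V) (hσ : ContDiffOn ℝ ∞ σ W) (hσV : MapsTo σ W V) :
    IsParallelNormalFrame (g ∘ σ) (fun i => ζ i ∘ σ) W := by
  refine ⟨fun a => (hζ.smooth a).comp hσ hσV, fun x hx => hζ.orthonormal _ (hσV hx),
    fun x hx a v => ?_, fun x hx a b v => ?_⟩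
  · rw [fderiv_comp x (differentiableAt_of_contDiffOn hV hg (hσV hx))
      (differentiableAt_of_contDiffOn hW hσ hx)]
    exact hζ.normal _ (hσV hx) a _
  · rw [fderiv_comp x (differentiableAt_of_contDiffOn hV (hζ.smooth b) (hσV hx))
      (differentiableAt_of_contDiffOn hW hσ hx)]
    exact hζ.parallel _ (hσV hx) a b _

/-- The normal space has an orthonormal basis whose `ℝ^m`-block does not have the eigenvalue
`1`. -/
lemma exists_orthonormal_normal {g : R n → RR n m} {y₀ : R n}
    (hinj : Function.Injective (fderiv ℝ g y₀)) :
    ∃ b : Fin m → RR n m, Orthonormal ℝ b ∧ (∀ i, b i ∈ normalSpace g y₀) ∧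
      IsUnit (1 - sndBlock b) := by
  have hdim : Module.finrank ℝ (normalSpace g y₀) = m := by
    have h1 := Submodule.finrank_add_finrank_orthogonal
      (LinearMap.range (fderiv ℝ g y₀ : R n →ₗ[ℝ] RR n m))
    have h2 := LinearMap.finrank_range_of_inj (f := (fderiv ℝ g y₀ : R n →ₗ[ℝ] RR n m)) hinj
    have h3 : Module.finrank ℝ (RR n m) = n + m := by simp
    have h4 : Module.finrank ℝ (R n) = n := by simp
    change _ + Module.finrank ℝ (normalSpace g y₀) = _ at h1
    omega
  set e := (stdOrthonormalBasis ℝ (normalSpace g y₀)).reindex (finCongr hdim) with he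
  have heo : Orthonormal ℝ fun i => (e i : RR n m) :=
    e.orthonormal.comp_linearIsometry (normalSpace g y₀).subtypeₗᵢ
  obtain ⟨ε, hε, hu⟩ := exists_signs_isUnit_one_sub (sndBlock fun i => (e i : RR n m))
  refine ⟨fun i => ε i • (e i : RR n m), ?_, fun i => Submodule.smul_mem _ _ (e i).2, hu⟩
  rw [orthonormal_iff_ite] at heo ⊢
  intro i j
  rw [real_inner_smul_left, real_inner_smul_right, heo]
  split_ifs with hij
  · subst hij
    rw [mul_one, hε]
  · simp

/-- **Local form of an immersion with flat normal bundle**, for a map defined on an open set. -/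
theorem FlatNormalBundleOn.exists_local_form {g : R n → RR n m} {S : Set (R n)} (hS : IsOpen S)
    (hg : IsImmersionOn g S) (hflat : FlatNormalBundleOn g S) {y₀ : R n} (hy₀ : y₀ ∈ S) :
    ∃ (Ψ : OpenPartialHomeomorph (R n) (R n)) (φ : Fin m → R n → ℝ)
      (Ω : R n → Matrix (Fin m) (Fin m) ℝ) (c : RR n m), y₀ ∈ Ψ.source ∧ Ψ.source ⊆ S ∧
      (∃ z, ∃ r > 0, Ψ.target = ball z r) ∧ ContDiffOn ℝ ∞ Ψ Ψ.source ∧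
      ContDiffOn ℝ ∞ Ψ.symm Ψ.target ∧ CommutingHessiansOn φ Ψ.target ∧
      IsAdapted φ Ω Ψ.target ∧ ∀ y ∈ Ψ.source, g y = ribaucourMap φ Ω (Ψ y) + c := by
  obtain ⟨b, hbo, hbn, hbu⟩ := exists_orthonormal_normal (hg.2 y₀ hy₀)
  obtain ⟨r, hr, hsub, ζ, hζ0, hζ⟩ := hflat.exists_parallelNormalFrame hS hg hy₀ hbo hbn
  -- translate so that the `ℝ^m`-component vanishes at `y₀`
  set c : RR n m := WithLp.toLp 2 (Sum.elim 0 (sndPart (g y₀))) with hc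
  set g₀ : R n → RR n m := fun y => g y - c with hg₀
  have hfd : ∀ y, fderiv ℝ g₀ y = fderiv ℝ g y := fun y => fderiv_sub_const c
  set D : Set (R n) := ball y₀ r ∩ {y | (1 - sndBlock fun i => ζ i y).det ≠ 0} with hD
  have hDopen : IsOpen D := by
    have hcont : ContinuousOn (fun y => (1 - sndBlock fun i => ζ i y).det) (ball y₀ r) :=
      (contDiffOn_matrix_det (A := fun y => 1 - sndBlock fun i => ζ i y)
        fun i j => contDiffOn_const.sub (contDiffOn_sndPart (hζ.smooth j) i)).continuousOn
    exact hcont.isOpen_inter_preimage isOpen_ball isOpen_ne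
  have hu : ∀ y ∈ D, IsUnit (1 - sndBlock fun i => ζ i y) := fun y hy =>
    (Matrix.isUnit_iff_isUnit_det _).2 (isUnit_iff_ne_zero.2 hy.2)
  have hy₀D : y₀ ∈ D := by
    refine ⟨mem_ball_self hr, ?_⟩
    change (1 - sndBlock fun i => ζ i y₀).det ≠ 0
    simp only [hζ0]
    exact ((Matrix.isUnit_iff_isUnit_det _).1 hbu).ne_zero
  have hDS : D ⊆ S := fun y hy => hsub hy.1
  have hg₀D : ContDiffOn ℝ ∞ g₀ D := (hg.1.mono hDS).sub contDiffOn_const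
  have hζ₀ : IsParallelNormalFrame g₀ ζ D :=
    ⟨fun a => (hζ.smooth a).mono inter_subset_left, fun y hy => hζ.orthonormal y hy.1,
      fun y hy a v => by rw [hfd]; exact hζ.normal y hy.1 a v,
      fun y hy => hζ.parallel y hy.1⟩
  set X := frameCoord g₀ ζ with hX
  have hXs : ContDiffOn ℝ ∞ X D := contDiffOn_frameCoord hg₀D hζ₀ hu
  -- smoothness of the inverse on a whole neighbourhood needs invertibility there
  set W : Set (R n) := D ∩ fderiv ℝ X ⁻¹' {L | Function.Injective L} with hW
  have hWopen : IsOpen W :=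
    ((hXs.fderiv_of_isOpen (m := ∞) hDopen le_rfl).continuousOn).isOpen_inter_preimage hDopen
      ContinuousLinearMap.isOpen_injective
  have hy₀W : y₀ ∈ W := by
    refine ⟨hy₀D, injective_fderiv_frameCoord hDopen hg₀D hζ₀ hu hy₀D ?_ ?_⟩
    · ext j
      exact sub_self _
    · rw [hfd]
      exact hg.2 y₀ hy₀
  obtain ⟨Ψ, hΨX, hΨ0, hΨW, ⟨ρ, hρ, hΨt⟩, hΨs⟩ := exists_diffeomorph_onto_ball hWopen
    (hXs.mono inter_subset_left) (fun y hy => hy.2) hy₀W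
  have hmaps : MapsTo Ψ.symm Ψ.target D := fun z hz => (hΨW (Ψ.map_target hz)).1
  have hζΨ := hζ₀.comp hDopen Ψ.open_target hg₀D hΨs hmaps
  obtain ⟨φ, Ω, hφ, hΩ, hrib⟩ := exists_eq_ribaucourMap_of_frameCoord_eq Ψ.open_target
    (hg₀D.comp hΨs hmaps) hζΨ (fun z hz => hu _ (hmaps hz))
    (fun z hz => (hΨX _).symm.trans (Ψ.right_inv hz))
  refine ⟨Ψ, φ, Ω, c, hΨ0, hΨW.trans (inter_subset_left.trans hDS), ⟨_, ρ, hρ, hΨt⟩,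
    (hXs.mono (hΨW.trans inter_subset_left)).congr fun y _ => hΨX y, hΨs, hφ, hΩ, fun y hy => ?_⟩
  rw [← hrib _ (Ψ.map_source hy), Function.comp_apply, Ψ.left_inv hy]
  exact (sub_add_cancel _ _).symm

end LocalForm

section Manifold

variable {n m : ℕ} {M : Type*} [TopologicalSpace M] [ChartedSpace (R n) M]
  [IsManifold (𝓡 n) ∞ M] {f : M → RR n m}

lemma IsSmoothImmersion.isImmersionOn_chart (hf : IsSmoothImmersion n f) (p : M) :
    IsImmersionOn (f ∘ (chartAt (R n) p).symm) (chartAt (R n) p).target := by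
  have : IsManifold (𝓡 n) 1 M := IsManifold.of_le (n := ∞) ENat.LEInfty.out
  refine ⟨contMDiffOn_iff_contDiffOn.1 (hf.1.comp_contMDiffOn contMDiffOn_chart_symm),
    fun x hx => ?_⟩
  have he := (mdifferentiable_chart (I := 𝓡 n) p)
  rw [← mfderiv_eq_fderiv, mfderiv_comp x (hf.1.mdifferentiableAt (by simp))
    (he.mdifferentiableAt_symm hx)]
  exact (hf.2 _).comp (he.symm.mfderiv_injective hx)

lemma simplyConnectedSpace_ball {z : R n} {r : ℝ} (hr : 0 < r) :
    SimplyConnectedSpace (ball z r) := by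
  have := (convex_ball z r).contractibleSpace ⟨z, mem_ball_self hr⟩
  infer_instance

/-- The local form in a chart around `p`, with the new coordinates composed with the chart. Both `U`
and `V` can be taken to be the same ball. -/
theorem HasFlatNormalBundle.exists_local_form (hf : IsSmoothImmersion n f)
    (hflat : HasFlatNormalBundle n f) (p : M) :
    ∃ (U V : Set (R n)) (φ : Fin m → R n → ℝ) (Ω : R n → Matrix (Fin m) (Fin m) ℝ)
      (ψ : OpenPartialHomeomorph M (R n)) (c : RR n m),
      IsOpen U ∧ SimplyConnectedSpace U ∧ CommutingHessiansOn φ U ∧ V ⊆ U ∧ IsOpen V ∧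
      IsAdapted φ Ω V ∧ ψ ∈ IsManifold.maximalAtlas (𝓡 n) ∞ M ∧ p ∈ ψ.source ∧ ψ.target = V ∧
      ∀ q ∈ ψ.source, f q = ribaucourMap φ Ω (ψ q) + c := by
  set e := chartAt (R n) p with he
  have hpe : p ∈ e.source := mem_chart_source _ p
  obtain ⟨Ψ, φ, Ω, c, hΨ0, hΨS, ⟨z, r, hr, hΨt⟩, hΨs, hΨs', hφ, hΩ, hrib⟩ :=
    (hflat e (chart_mem_atlas _ p)).exists_local_form e.open_target
      (hf.isImmersionOn_chart p) (e.map_source hpe)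
  have htarget : (e.trans Ψ).target = Ψ.target := by
    rw [OpenPartialHomeomorph.trans_target]
    exact inter_eq_left.2 fun x hx => hΨS (Ψ.map_target hx)
  refine ⟨Ψ.target, Ψ.target, φ, Ω, e.trans Ψ, c, Ψ.open_target, ?_, hφ, subset_rfl,
    Ψ.open_target, hΩ, ?_, ?_, htarget, fun q hq => ?_⟩
  · rw [hΨt]
    exact simplyConnectedSpace_ball hr
  · refine OpenPartialHomeomorph.mem_maximalAtlas_of_contMDiffOn _ ?_ ?_
    · exact (contMDiffOn_iff_contDiffOn.2 hΨs).comp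
        ((contMDiffOn_chart (I := 𝓡 n) (n := ∞) (x := p)).mono fun q hq => hq.1) fun q hq => hq.2
    · rw [htarget]
      exact (contMDiffOn_chart_symm (I := 𝓡 n) (n := ∞) (x := p)).comp
        (contMDiffOn_iff_contDiffOn.2 hΨs') fun x hx => hΨS (Ψ.map_target hx)
  · exact ⟨hpe, hΨ0⟩
  · have := hrib (e q) hq.2
    rwa [Function.comp_apply, e.left_inv hq.1] at this

end Manifold

end FlatNormal

end

theorem theorem1 (n m : ℕ) :
    -- the direct statement
    (∀ (U : Set (FlatNormal.R n)) (φ : Fin m → FlatNormal.R n → ℝ),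
      IsOpen U → SimplyConnectedSpace U → FlatNormal.CommutingHessiansOn φ U →
        (∀ x ∈ U, ∃ V ⊆ U, IsOpen V ∧ x ∈ V ∧
          ∃ Ω : FlatNormal.R n → Matrix (Fin m) (Fin m) ℝ, FlatNormal.IsAdapted φ Ω V) ∧
        (∀ V ⊆ U, IsOpen V → ∀ Ω : FlatNormal.R n → Matrix (Fin m) (Fin m) ℝ,
          FlatNormal.IsAdapted φ Ω V →
            ContDiffOn ℝ ∞ (FlatNormal.ribaucourMap φ Ω) V ∧
            IsOpen (FlatNormal.regularPoints (FlatNormal.ribaucourMap φ Ω) V) ∧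
            FlatNormal.IsImmersionOn (FlatNormal.ribaucourMap φ Ω)
              (FlatNormal.regularPoints (FlatNormal.ribaucourMap φ Ω) V) ∧
            FlatNormal.FlatNormalBundleOn (FlatNormal.ribaucourMap φ Ω)
              (FlatNormal.regularPoints (FlatNormal.ribaucourMap φ Ω) V))) ∧
    -- the converse
    (∀ (M : Type*) [TopologicalSpace M] [ChartedSpace (FlatNormal.R n) M]
      [IsManifold (𝓡 n) ∞ M] (f : M → FlatNormal.RR n m),
      FlatNormal.IsSmoothImmersion n f → FlatNormal.HasFlatNormalBundle n f →
        ∀ p : M, ∃ (U V : Set (FlatNormal.R n)) (φ : Fin m → FlatNormal.R n → ℝ)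
          (Ω : FlatNormal.R n → Matrix (Fin m) (Fin m) ℝ)
          (ψ : OpenPartialHomeomorph M (FlatNormal.R n)) (c : FlatNormal.RR n m),
          IsOpen U ∧ SimplyConnectedSpace U ∧ FlatNormal.CommutingHessiansOn φ U ∧
          V ⊆ U ∧ IsOpen V ∧ FlatNormal.IsAdapted φ Ω V ∧
          ψ ∈ IsManifold.maximalAtlas (𝓡 n) ∞ M ∧ p ∈ ψ.source ∧ ψ.target = V ∧
          ∀ q ∈ ψ.source, f q = FlatNormal.ribaucourMap φ Ω (ψ q) + c) := by
  refine ⟨fun U φ hU _ hφ => ⟨fun x hx => ?_, fun V hVU hV Ω hΩ => ?_⟩,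
    fun M _ _ _ f hf hflat p => hflat.exists_local_form hf p⟩
  · obtain ⟨r, hr, hball⟩ := Metric.isOpen_iff.1 hU x hx
    obtain ⟨Ω, hΩ⟩ := FlatNormal.exists_isAdapted_ball (x := x) (r := r) (φ := φ)
      ⟨fun i => (hφ.1 i).mono hball, fun y hy => hφ.2 y (hball hy)⟩
    exact ⟨Metric.ball x r, hball, Metric.isOpen_ball, Metric.mem_ball_self hr, Ω, hΩ⟩
  · have hφV := fun i => (hφ.1 i).mono hVU
    have hs := hΩ.contDiffOn_ribaucourMap hV hφV
    exact ⟨hs, hΩ.isOpen_regularPoints hV hφV, ⟨hs.mono fun x hx => hx.1, fun x hx => hx.2⟩,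
      hΩ.flatNormalBundleOn hV hφV⟩
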